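/- For a finite simple graph $G=([n],E)$ let $\mathcal{P}_G=\operatorname{conv}\{\pm(e_i-e_j) : ij\in E\}\subset\mathbb{R}^n$ be its symmetric edge polytope, and let $d=\dim\mathcal{P}_G$. Let $h^*(\mathcal{P}_G)=(h_0^*,\dots,h_d^*)$ be its $h^*$-vector, defined by $$|k\mathcal{P}_G\cap\mathbb{Z}^n|=\sum_{j=0}^{d}h_j^*\binom{k+d-j}{d}\quad\text{for all integers }k\ge 0,$$ and let $\gamma(\mathcal{P}_G)=(\gamma_0,\dots,\gamma_{\lfloor d/2\rfloor})$ be its $\gamma$-vector, defined by $$\sum_{i=0}^{\lfloor d/2\rfloor}\gamma_i\,t^i(t+1)^{d-2i}=\sum_{j=0}^{d}h_j^*t^j,$$ with the convention $\gamma_i=0$ for $i>\lfloor d/2\rfloor$ (the $h^*$-vector and the $\gamma$-vector exist, since $\mathcal{P}_G$ is a reflexive lattice polytope). Let $G=([n],E)$ be a $2$-connected graph, i.e. $n\ge 3$, $G$ is connected, and $G$ remains connected after deleting any one vertex. Then $\gamma_2(\mathcal{P}_G)=0$ if and only if either $n<5$, or $n\ge 5$ and $G$ is isomorphic to $G_n$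 or to the complete bipartite graph $K_{2,n-2}$, where $G_n$ is the graph on $[n]$ obtained from $K_{2,n-2}$, with bipartition $[n]=\{1,2\}\cup\{3,\dots,n\}$, by adding the edge $12$. -/

import Mathlib

/-- `G` is 2-connected: it has at least three vertices, it is connected, and it stays connected
when any one vertex is deleted. -/
def IsTwoConnected {n : ℕ} (G : SimpleGraph (Fin n)) : Prop :=
  3 ≤ n ∧ G.Connected ∧ ∀ v : Fin n, (G.induce {w | w ≠ v}).Connected

/-- The symmetric edge polytope `conv {±(eᵢ - eⱼ) : ij ∈ E}` in `ℝⁿ`. Both signs occur because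
adjacency is symmetric. -/
def symmetricEdgePolytope {n : ℕ} (G : SimpleGraph (Fin n)) : Set (Fin n → ℝ) :=
  convexHull ℝ {x | ∃ i j : Fin n, G.Adj i j ∧ x = Pi.single i (1 : ℝ) - Pi.single j (1 : ℝ)}

/-- The dimension of a polytope, i.e. the dimension of its affine hull. -/
noncomputable def polytopeDim {n : ℕ} (P : Set (Fin n → ℝ)) : ℕ :=
  Module.finrank ℝ (vectorSpan ℝ P)

open scoped Pointwise in
/-- The number of points of `ℤⁿ` in the `k`-th dilation `k • P`. -/
noncomputable def ehrhart {n : ℕ} (P : Set (Fin n → ℝ)) (k : ℕ) : ℕ :=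
  Set.ncard {z : Fin n → ℤ | (fun i => (z i : ℝ)) ∈ (k : ℝ) • P}

/-- The sequence `h` with `∑ₖ E(k) tᵏ = (∑ⱼ hⱼ tʲ) / (1 - t) ^ (d + 1)`. -/
noncomputable def hStarOfEhrhart (d : ℕ) (E : ℕ → ℤ) (j : ℕ) : ℤ :=
  PowerSeries.coeff j ((1 - PowerSeries.X) ^ (d + 1) * PowerSeries.mk E)

/-- `hStarOfEhrhart` inverts the change of basis
`E(k) = h₀ (k + d choose d) + h₁ (k + d - 1 choose d) + ⋯ + h_d (k choose d)`. -/
theorem hStarOfEhrhart_eq (d : ℕ) (E h : ℕ → ℤ)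
    (hE : ∀ k : ℕ, E k = ∑ j ∈ Finset.range (d + 1), h j * ((k + d - j).choose d : ℤ))
    (j : ℕ) (hj : j ≤ d) : hStarOfEhrhart d E j = h j := by
  have key : PowerSeries.mk E =
      (∑ i ∈ Finset.range (d + 1), PowerSeries.C (h i) * PowerSeries.X ^ i) *
        (PowerSeries.invOneSubPow ℤ (d + 1)).val := by
    ext k
    rw [PowerSeries.coeff_mk, hE, Finset.sum_mul, map_sum]
    refine Finset.sum_congr rfl fun i hi => ?_
    rw [mul_assoc, PowerSeries.coeff_C_mul, PowerSeries.coeff_X_pow_mul',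
      PowerSeries.invOneSubPow_val_succ_eq_mk_add_choose]
    have hi' : i ≤ d := by simpa [Nat.lt_succ_iff] using hi
    split_ifs with hik
    · rw [PowerSeries.coeff_mk]
      congr 3
      omega
    · rw [Nat.choose_eq_zero_of_lt (by omega)]
      simp
  have inv : (1 - PowerSeries.X : PowerSeries ℤ) ^ (d + 1) *
      (PowerSeries.invOneSubPow ℤ (d + 1)).val = 1 := by
    rw [← PowerSeries.invOneSubPow_inv_eq_one_sub_pow]
    exact (PowerSeries.invOneSubPow ℤ (d + 1)).inv_val
  unfold hStarOfEhrhart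
  rw [key, mul_left_comm, inv, mul_one, map_sum]
  simp only [PowerSeries.coeff_C_mul, PowerSeries.coeff_X_pow, mul_ite, mul_one, mul_zero]
  rw [Finset.sum_ite_eq, if_pos (by simpa [Nat.lt_succ_iff] using hj)]

/-- The entry `h*ⱼ(P)` of the `h*`-vector of a lattice polytope `P`. -/
noncomputable def hStar {n : ℕ} (P : Set (Fin n → ℝ)) (j : ℕ) : ℤ :=
  hStarOfEhrhart (polytopeDim P) (fun k => (ehrhart P k : ℤ)) j

/-- The entry `γₖ` of the `γ`-vector `(γ₀, …, γ_⌊d/2⌋)` of a symmetric vector `(h₀, …, h_d)`,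
with `γₖ = 0` for `k > ⌊d/2⌋`; it is obtained by comparing the coefficients of `tᵏ` in
`∑ᵢ γᵢ tⁱ (t + 1) ^ (d - 2 i) = ∑ⱼ hⱼ tʲ`. -/
def gammaOfH (d : ℕ) (h : ℕ → ℤ) (k : ℕ) : ℤ :=
  if k ≤ d / 2 then
    h k - ∑ i : Fin k, gammaOfH d h i * ((d - 2 * (i : ℕ)).choose (k - i) : ℤ)
  else 0
termination_by k
decreasing_by exact i.isLt

/-- `gammaOfH` inverts the change of basis `∑ᵢ γᵢ tⁱ (t + 1) ^ (d - 2 i) = ∑ⱼ hⱼ tʲ`. -/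
theorem gammaOfH_eq (d : ℕ) (h g : ℕ → ℤ)
    (hg : ∑ i ∈ Finset.range (d / 2 + 1), Polynomial.C (g i) * Polynomial.X ^ i *
        (Polynomial.X + 1) ^ (d - 2 * i) =
      ∑ j ∈ Finset.range (d + 1), Polynomial.C (h j) * Polynomial.X ^ j)
    (k : ℕ) (hk : k ≤ d / 2) : gammaOfH d h k = g k := by
  induction k using Nat.strong_induction_on with
  | _ k ih =>
    have hc := congrArg (fun p => Polynomial.coeff p k) hg
    simp only [Polynomial.finsetSum_coeff, mul_assoc, Polynomial.coeff_C_mul,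
      Polynomial.coeff_X_pow_mul', Polynomial.coeff_X_add_one_pow, Polynomial.coeff_X_pow,
      mul_ite, mul_one, mul_zero] at hc
    rw [Finset.sum_ite_eq, if_pos (Finset.mem_range.2 (by omega)),
      ← Finset.sum_filter] at hc
    have hs : (Finset.range (d / 2 + 1)).filter (fun i => i ≤ k) = Finset.range (k + 1) := by
      ext i
      simp only [Finset.mem_filter, Finset.mem_range]
      omega
    rw [hs, Finset.sum_range_succ] at hc
    have hsum : ∑ i : Fin k, gammaOfH d h i * ((d - 2 * (i : ℕ)).choose (k - i) : ℤ) =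
        ∑ i ∈ Finset.range k, g i * ((d - 2 * i).choose (k - i) : ℤ) := by
      rw [Fin.sum_univ_eq_sum_range
        (fun i => gammaOfH d h i * ((d - 2 * i).choose (k - i) : ℤ)) k]
      refine Finset.sum_congr rfl fun i hi => ?_
      have hi' := Finset.mem_range.1 hi
      rw [ih i hi' (by omega)]
    rw [gammaOfH, if_pos hk, hsum, ← hc]
    simp

/-- For a symmetric vector, `gammaOfH` does satisfy the defining identity of the `γ`-vector. -/
theorem gammaOfH_spec (d : ℕ) (h : ℕ → ℤ) (hsymm : ∀ j ≤ d, h (d - j) = h j) :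
    ∑ i ∈ Finset.range (d / 2 + 1), Polynomial.C (gammaOfH d h i) * Polynomial.X ^ i *
        (Polynomial.X + 1) ^ (d - 2 * i) =
      ∑ j ∈ Finset.range (d + 1), Polynomial.C (h j) * Polynomial.X ^ j := by
  have low : ∀ m ≤ d / 2, (∑ i ∈ Finset.range (d / 2 + 1),
      if i ≤ m then gammaOfH d h i * ((d - 2 * i).choose (m - i) : ℤ) else 0) = h m := by
    intro m hm
    have hs : (Finset.range (d / 2 + 1)).filter (fun i => i ≤ m) = Finset.range (m + 1) := by
      ext i
      simp only [Finset.mem_filter, Finset.mem_range]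
      omega
    have hg : gammaOfH d h m =
        h m - ∑ i : Fin m, gammaOfH d h i * ((d - 2 * (i : ℕ)).choose (m - i) : ℤ) := by
      rw [gammaOfH, if_pos hm]
    rw [← Finset.sum_filter, hs, Finset.sum_range_succ, hg, Fin.sum_univ_eq_sum_range
      (fun i => gammaOfH d h i * ((d - 2 * i).choose (m - i) : ℤ)) m]
    simp
  ext m
  simp only [Polynomial.finsetSum_coeff, mul_assoc, Polynomial.coeff_C_mul,
    Polynomial.coeff_X_pow_mul', Polynomial.coeff_X_add_one_pow, Polynomial.coeff_X_pow,
    mul_ite, mul_one, mul_zero]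
  rw [Finset.sum_ite_eq]
  by_cases hmd : m ≤ d
  · rw [if_pos (Finset.mem_range.2 (by omega))]
    by_cases hm : m ≤ d / 2
    · exact low m hm
    · rw [← hsymm m hmd, ← low (d - m) (by omega)]
      refine Finset.sum_congr rfl fun i hi => ?_
      have hi' := Finset.mem_range.1 hi
      rw [if_pos (by omega : i ≤ m)]
      split_ifs with h2
      · rw [← Nat.choose_symm (by omega : d - m - i ≤ d - 2 * i)]
        congr 3
        omega
      · rw [Nat.choose_eq_zero_of_lt (by omega)]
        simp
  · rw [if_neg (by simp; omega)]
    refine Finset.sum_eq_zero fun i hi => ?_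
    have hi' := Finset.mem_range.1 hi
    rw [Nat.choose_eq_zero_of_lt (by omega)]
    simp

/-- The entry `γₖ(P)` of the `γ`-vector of a reflexive lattice polytope `P`. -/
noncomputable def gammaEntry {n : ℕ} (P : Set (Fin n → ℝ)) (k : ℕ) : ℤ :=
  gammaOfH (polytopeDim P) (hStar P) k

/-- The graph `G_n` (for `n ≥ 3`): the complete bipartite graph `K_{2,n-2}` with an edge added
between the two vertices of the part of size two. -/
def graphGn (n : ℕ) : SimpleGraph (Fin 2 ⊕ Fin (n - 2)) :=
  completeBipartiteGraph (Fin 2) (Fin (n - 2)) ⊔ SimpleGraph.edge (Sum.inl 0) (Sum.inl 1)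

/-! For n < 5 the polytope has dimension n - 1 ≤ 3, and γ₂ = 0 by convention. For n ≥ 5, γ₂ is
determined by the dimension and the numbers of lattice points of P and 2P. Integer functions on the
vertices that change by at most one along each edge give inequalities strong enough to identify
these points: 0, the vectors e_i - e_j with i, j at distance at most 1 (in P) or 2 (in 2P), and, in
2P only, e_i + e_j - e_a - e_b with {i, j} and {a, b} disjoint and matched by two edges. Counting
them gives 4γ₂ = 2c(c + 4) - ∑ w(i, j), where c is twice the cyclomatic number and w depends only on
adjacency and the number of common neighbours (`four_mul_gammaEntry_two`, `gammaForm`).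

The form is studied by deleting a vertex v. Let H = G - v be connected, N the neighbourhood of v and
k = #N. By `gammaForm_eq_induce` the form of G is that of H plus three corrections: the slack in a
bound of the total excess of N by (2k - 3) c(H), the slack in a bound of `linkSum`, and a multiple
of the number of pairs of N at distance more than 2 in H. For k ≥ 2 all three are nonnegative: the
excess bound follows by deleting non-bridges until a tree remains, the other by sending each vertex
remote from N to the first edge of a shortest path. Hence the form is nonnegative on connected
graphs, and if it vanishes on a 2-connected graph then so do the corrections at every v.

Suppose it vanishes and n ≥ 5. If all degrees were at most 2, the far-pair correction would close a
cycle of length 3 or 4 which is all of G; so some v has degree at least 3. Equality in the excess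
bound makes H a tree or a unicyclic graph whose cycle is a triangle on N, and the second case forces
n = 4. In the tree H every leaf lies in N by 2-connectedness, and any two leaves are at distance at
most 2, so H is a star with some centre z. Thus every other vertex is adjacent to exactly v and z
(`IsBook`), and G is K_{2,n-2} with or without the edge vz. Conversely, the form of such a graph is
computed directly. -/

open Finset

/-! ### Adjacency indicators, codegrees, and the quadratic form of a graph -/

section Indicators

variable {V : Type} (G : SimpleGraph V)

open Classical in
/-- The adjacency matrix with integer entries. -/
noncomputable def adjInd (i j : V) : ℤ := if G.Adj i j then 1 else 0

theorem adjInd_of_adj {i j : V} (h : G.Adj i j) : adjInd G i j = 1 := if_pos h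

theorem adjInd_of_not_adj {i j : V} (h : ¬ G.Adj i j) : adjInd G i j = 0 := if_neg h

theorem adjInd_comm (i j : V) : adjInd G i j = adjInd G j i := by
  have := G.adj_comm i j
  unfold adjInd
  split_ifs <;> tauto

@[simp] theorem adjInd_self (i : V) : adjInd G i i = 0 := by simp [adjInd]

theorem adjInd_eq_zero_or_one (i j : V) : adjInd G i j = 0 ∨ adjInd G i j = 1 := by
  by_cases h : G.Adj i j
  · exact Or.inr (adjInd_of_adj G h)
  · exact Or.inl (adjInd_of_not_adj G h)

theorem adjInd_nonneg (i j : V) : 0 ≤ adjInd G i j := by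
  rcases adjInd_eq_zero_or_one G i j with h | h <;> simp [h]

theorem adjInd_mul_self (i j : V) : adjInd G i j * adjInd G i j = adjInd G i j := by
  rcases adjInd_eq_zero_or_one G i j with h | h <;> simp [h]

open Classical in
theorem adjInd_deleteEdges (a b i j : V) :
    adjInd (G.deleteEdges {s(a, b)}) i j =
      if (i = a ∧ j = b) ∨ (i = b ∧ j = a) then 0 else adjInd G i j := by
  unfold adjInd
  simp only [SimpleGraph.deleteEdges_adj, Set.mem_singleton_iff, Sym2.eq_iff]
  split_ifs <;> tauto

variable [Fintype V]

/-- The number of common neighbours of two vertices. -/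
noncomputable def codeg (i j : V) : ℤ := ∑ x, adjInd G i x * adjInd G x j

/-- The number of ordered pairs of adjacent vertices. -/
noncomputable def arcs : ℤ := ∑ i, ∑ j, adjInd G i j

/-- Twice the cyclomatic number of a connected graph. -/
noncomputable def cyc2 : ℤ := arcs G - 2 * Fintype.card V + 2

open Classical in
/-- The indicator of pairs of vertices which are neither adjacent nor have a common neighbour. -/
noncomputable def farInd (i j : V) : ℤ := if ¬ G.Adj i j ∧ codeg G i j = 0 then 1 else 0

/-- The number of independent cycles in the union of the paths of length at most two between two
distinct vertices. -/
noncomputable def excess (i j : V) : ℤ := codeg G i j - 1 + adjInd G i j + farInd G i j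

/-- The contribution of a pair of vertices to `gammaForm`. -/
noncomputable def pairWeight (i j : V) : ℤ :=
  codeg G i j ^ 2 + 3 * codeg G i j - 4 * (1 - adjInd G i j - farInd G i j)

open Classical in
/-- The sum of the contributions of the ordered pairs of distinct vertices to `gammaForm`. -/
noncomputable def totalWeight : ℤ := ∑ i, ∑ j, if i = j then 0 else pairWeight G i j

/-- Four times the second entry of the `γ`-vector of the symmetric edge polytope of `G`. -/
noncomputable def gammaForm : ℤ :=
  2 * cyc2 G * (cyc2 G + 4) - totalWeight G

theorem codeg_comm (i j : V) : codeg G i j = codeg G j i := by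
  unfold codeg
  refine sum_congr rfl fun x _ => ?_
  rw [adjInd_comm G i x, adjInd_comm G x j, mul_comm]

theorem codeg_nonneg (i j : V) : 0 ≤ codeg G i j :=
  sum_nonneg fun _ _ => mul_nonneg (adjInd_nonneg _ _ _) (adjInd_nonneg _ _ _)

theorem codeg_eq_zero_iff {i j : V} : codeg G i j = 0 ↔ ∀ x, ¬ (G.Adj i x ∧ G.Adj x j) := by
  unfold codeg
  rw [sum_eq_zero_iff_of_nonneg
    fun _ _ => mul_nonneg (adjInd_nonneg _ _ _) (adjInd_nonneg _ _ _)]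
  simp only [mem_univ, forall_const, adjInd, mul_ite, mul_one, mul_zero, ite_eq_right_iff,
    one_ne_zero, imp_false, not_and]
  exact forall_congr' fun x => by tauto

theorem codeg_eq_card (i j : V) [DecidablePred fun x => G.Adj i x ∧ G.Adj x j] :
    codeg G i j = #{x | G.Adj i x ∧ G.Adj x j} := by
  unfold codeg adjInd
  rw [card_filter]
  push_cast
  refine sum_congr rfl fun x _ => ?_
  by_cases h1 : G.Adj i x <;> by_cases h2 : G.Adj x j <;> simp [h1, h2]

theorem farInd_comm (i j : V) : farInd G i j = farInd G j i := by
  have := G.adj_comm i j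
  unfold farInd
  rw [codeg_comm G i j]
  split_ifs <;> tauto

theorem farInd_nonneg (i j : V) : 0 ≤ farInd G i j := by
  unfold farInd; split_ifs <;> simp

theorem pairWeight_comm (i j : V) : pairWeight G i j = pairWeight G j i := by
  simp only [pairWeight, codeg_comm G i j, adjInd_comm G i j, farInd_comm G i j]

open Classical in
theorem arcs_eq : arcs G = 2 * Nat.card G.edgeSet := by
  have h := G.sum_degrees_eq_twice_card_edges
  unfold arcs adjInd
  have : ∀ i, (∑ j, if G.Adj i j then (1 : ℤ) else 0) = G.degree i := by
    intro i
    rw [← G.card_neighborFinset_eq_degree, SimpleGraph.neighborFinset_eq_filter, card_filter]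
    push_cast; rfl
  simp only [this]
  rw [Nat.card_eq_fintype_card, ← SimpleGraph.edgeFinset_card]
  exact_mod_cast h

theorem cyc2_eq : cyc2 G = 2 * ((Nat.card G.edgeSet : ℤ) + 1 - Nat.card V) := by
  rw [cyc2, arcs_eq, Nat.card_eq_fintype_card (α := V)]; ring

variable {G}

/-- Presents the cyclomatic number as a natural number, so that one can induct on it with trees as
the base case. -/
theorem SimpleGraph.Connected.exists_cyc2_eq (h : G.Connected) :
    ∃ m : ℕ, cyc2 G = 2 * m ∧ (m = 0 ↔ G.IsTree) := by
  have h1 := h.card_vert_le_card_edgeSet_add_one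
  refine ⟨Nat.card G.edgeSet + 1 - Nat.card V, ?_, ?_⟩
  · rw [cyc2_eq]; push_cast [h1]; ring
  · rw [SimpleGraph.isTree_iff_connected_and_card, and_iff_right h]
    omega

theorem cyc2_deleteEdges {a b : V} (h : G.Adj a b) :
    cyc2 (G.deleteEdges {s(a, b)}) = cyc2 G - 2 := by
  classical
  have hne : a ≠ b := h.ne
  have key : ∀ i j, adjInd (G.deleteEdges {s(a, b)}) i j =
      adjInd G i j - (if i = a then if j = b then 1 else 0 else 0) -
        (if i = b then if j = a then 1 else 0 else 0) := by
    intro i j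
    rw [adjInd_deleteEdges]
    by_cases h1 : i = a <;> by_cases h2 : j = b <;> by_cases h3 : i = b <;>
      by_cases h4 : j = a <;> simp_all [adjInd_of_adj, G.adj_comm]
  unfold cyc2 arcs
  simp only [key, sum_sub_distrib, sum_ite_irrel, sum_const_zero, sum_ite_eq', mem_univ, if_true]
  ring

/-- Paths in a tree are unique, so at most one path of length at most two joins `a` to `b`; `farInd`
compensates when there is none. -/
theorem SimpleGraph.IsTree.excess_eq_zero (h : G.IsTree) {a b : V} (hab : a ≠ b) :
    excess G a b = 0 := by
  classical
  have two : ∀ x, G.Adj a x ∧ G.Adj x b → ∃ p : G.Path a b, p.1.support = [a, x, b] := by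
    rintro x ⟨h1, h2⟩
    refine ⟨⟨.cons h1 (.cons h2 .nil), ?_⟩, by simp⟩
    simp [SimpleGraph.Walk.cons_isPath_iff, hab, h1.ne, h2.ne]
  have uniq := fun p q : G.Path a b => (h.isAcyclic.subsingleton_path a b).elim p q
  have hle : codeg G a b ≤ 1 := by
    rw [codeg_eq_card]
    norm_cast
    refine card_le_one.2 fun x hx y hy => ?_
    obtain ⟨p, hp⟩ := two x (by simpa using hx)
    obtain ⟨q, hq⟩ := two y (by simpa using hy)
    rw [uniq p q, hq] at hp
    simpa using hp.symm
  have hge := codeg_nonneg G a b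
  have hadj : G.Adj a b → codeg G a b = 0 := by
    intro hadj
    rw [codeg_eq_zero_iff]
    intro x hx
    obtain ⟨p, hp⟩ := two x hx
    rw [uniq p (.singleton hadj)] at hp
    simp [SimpleGraph.Path.singleton] at hp
  unfold excess farInd adjInd
  by_cases h1 : G.Adj a b
  · simp [h1, hadj h1]
  · simp only [h1, if_false, not_false_eq_true, true_and]
    split_ifs <;> omega

end Indicators

/-! ### Deleting an edge -/

section Excess

set_option linter.unusedSectionVars false

variable {V : Type} [Fintype V]

open Classical in
/-- The total excess of the ordered pairs of distinct elements of `N`. -/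
noncomputable def totalExcess (G : SimpleGraph V) (N : Finset V) : ℤ :=
  ∑ i ∈ N, ∑ j ∈ N, if i = j then 0 else excess G i j

open Classical in
/-- The number of elements of `N` other than `a` and `b` that are adjacent to `b`, if `a ∈ N`. -/
noncomputable def triangleCount (G : SimpleGraph V) (N : Finset V) (a b : V) : ℕ :=
  if a ∈ N then #{y ∈ N | y ≠ a ∧ y ≠ b ∧ G.Adj b y} else 0

variable {G : SimpleGraph V}

open Classical in
-- A common neighbour x of i and j is lost only if ab is one of the edges ix, xj. The indicators are
-- the four ways this can happen, and each fixes x.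
theorem codeg_le_deleteEdges (a b i j : V) :
    codeg G i j ≤ codeg (G.deleteEdges {s(a, b)}) i j +
      ((if i = a ∧ j ≠ b ∧ G.Adj b j then 1 else 0) + (if i = b ∧ j ≠ a ∧ G.Adj a j then 1 else 0) +
      (if j = a ∧ i ≠ b ∧ G.Adj b i then 1 else 0) +
      (if j = b ∧ i ≠ a ∧ G.Adj a i then 1 else 0)) := by
  have hmem : ∀ (p : Prop) [Decidable p] (y x : V),
      x ∈ (if p then ({y} : Finset V) else ∅) ↔ p ∧ x = y := by
    intro p _ y x; split_ifs with h <;> simp [h]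
  have hsub : ({x | G.Adj i x ∧ G.Adj x j} : Finset V) ⊆
      ({x | (G.deleteEdges {s(a, b)}).Adj i x ∧ (G.deleteEdges {s(a, b)}).Adj x j} : Finset V) ∪
      ((if i = a ∧ j ≠ b ∧ G.Adj b j then {b} else ∅) ∪
      (if i = b ∧ j ≠ a ∧ G.Adj a j then {a} else ∅) ∪
      (if j = a ∧ i ≠ b ∧ G.Adj b i then {b} else ∅) ∪
      (if j = b ∧ i ≠ a ∧ G.Adj a i then {a} else ∅)) := by
    intro x hx
    obtain ⟨h1, h2⟩ : G.Adj i x ∧ G.Adj x j := by simpa using hx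
    have hi := h1.symm
    have n1 := h1.ne
    have n2 := h2.ne
    simp only [mem_union, mem_filter, mem_univ, true_and, SimpleGraph.deleteEdges_adj,
      Set.mem_singleton_iff, Sym2.eq_iff, hmem]
    by_cases c1 : i = a ∧ x = b
    · obtain ⟨rfl, rfl⟩ := c1
      exact Or.inr (Or.inl (Or.inl (Or.inl ⟨⟨rfl, n2.symm, h2⟩, rfl⟩)))
    by_cases c2 : i = b ∧ x = a
    · obtain ⟨rfl, rfl⟩ := c2
      exact Or.inr (Or.inl (Or.inl (Or.inr ⟨⟨rfl, n2.symm, h2⟩, rfl⟩)))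
    by_cases c3 : x = b ∧ j = a
    · obtain ⟨rfl, rfl⟩ := c3
      exact Or.inr (Or.inl (Or.inr ⟨⟨rfl, n1, hi⟩, rfl⟩))
    by_cases c4 : x = a ∧ j = b
    · obtain ⟨rfl, rfl⟩ := c4
      exact Or.inr (Or.inr ⟨⟨rfl, n1, hi⟩, rfl⟩)
    left
    tauto
  have h := (card_le_card hsub).trans <| (card_union_le _ _).trans <| Nat.add_le_add_left
    ((card_union_le _ _).trans <| Nat.add_le_add_right
      ((card_union_le _ _).trans <| Nat.add_le_add_right (card_union_le _ _) _) _) _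
  have hc : ∀ (p : Prop) [Decidable p] (x : V),
      #(if p then ({x} : Finset V) else ∅) = if p then 1 else 0 := by
    intro p _ x; split_ifs <;> simp
  simp only [hc] at h
  rw [codeg_eq_card, codeg_eq_card]
  exact_mod_cast h

open Classical in
-- The excess equals max(codegree + adjacency - 1, 0), so it drops by no more than the codegree and
-- the adjacency do together.
theorem excess_le_deleteEdges (a b i j : V) :
    excess G i j ≤ excess (G.deleteEdges {s(a, b)}) i j +
      (((if i = a ∧ j = b then 1 else 0) + (if i = b ∧ j = a then 1 else 0)) +
      ((if i = a ∧ j ≠ b ∧ G.Adj b j then 1 else 0) + (if i = b ∧ j ≠ a ∧ G.Adj a j then 1 else 0) +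
      (if j = a ∧ i ≠ b ∧ G.Adj b i then 1 else 0) +
      (if j = b ∧ i ≠ a ∧ G.Adj a i then 1 else 0))) := by
  have h := codeg_le_deleteEdges (G := G) a b i j
  have h0 := codeg_nonneg G i j
  have h0' := codeg_nonneg (G.deleteEdges {s(a, b)}) i j
  have hadj : (G.deleteEdges {s(a, b)}).Adj i j ↔
      G.Adj i j ∧ ¬ ((i = a ∧ j = b) ∨ (i = b ∧ j = a)) := by
    simp [SimpleGraph.deleteEdges_adj]
  unfold excess farInd adjInd
  set X := (if i = a ∧ j ≠ b ∧ G.Adj b j then (1 : ℤ) else 0) +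
    (if i = b ∧ j ≠ a ∧ G.Adj a j then 1 else 0) + (if j = a ∧ i ≠ b ∧ G.Adj b i then 1 else 0) +
    (if j = b ∧ i ≠ a ∧ G.Adj a i then (1 : ℤ) else 0) with hX
  have hX0 : 0 ≤ X := by
    rw [hX]; exact add_nonneg (add_nonneg (add_nonneg
      (by split_ifs <;> simp) (by split_ifs <;> simp)) (by split_ifs <;> simp))
      (by split_ifs <;> simp)
  set Y : ℤ := (if i = a ∧ j = b then 1 else 0) + (if i = b ∧ j = a then 1 else 0) with hY
  have hY0 : 0 ≤ Y := by
    rw [hY]; exact add_nonneg (by split_ifs <;> simp) (by split_ifs <;> simp)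
  have hY1 : ((i = a ∧ j = b) ∨ (i = b ∧ j = a)) → 1 ≤ Y := by
    rintro (e | e) <;> rw [hY, if_pos e] <;> split_ifs <;> simp
  rw [hadj]
  clear_value X Y
  by_cases e1 : (i = a ∧ j = b) ∨ (i = b ∧ j = a)
  · have := hY1 e1
    simp only [e1, not_true, and_false, if_false, not_false_eq_true, true_and]
    split_ifs <;> omega
  · simp only [e1, not_false_eq_true, and_true]
    by_cases e3 : G.Adj i j
    · simp only [e3, not_true, false_and, if_true, if_false]
      omega
    · simp only [e3, not_false_eq_true, true_and, if_false]
      split_ifs <;> omega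

open Classical in
theorem sum_triangle (N : Finset V) (a b : V) (hab : a ≠ b) :
    (∑ i ∈ N, ∑ j ∈ N, if i = j then 0 else
      if i = a ∧ j ≠ b ∧ G.Adj b j then (1 : ℤ) else 0) = triangleCount G N a b := by
  have : ∀ i ∈ N, (∑ j ∈ N, if i = j then 0 else
      if i = a ∧ j ≠ b ∧ G.Adj b j then (1 : ℤ) else 0) =
      if i = a then (#{y ∈ N | y ≠ a ∧ y ≠ b ∧ G.Adj b y} : ℤ) else 0 := by
    intro i _
    split_ifs with h
    · subst h
      rw [card_filter]
      push_cast
      refine sum_congr rfl fun j _ => ?_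
      by_cases h1 : i = j
      · simp [h1]
      · simp [h1, Ne.symm h1]
    · simp [h]
  rw [sum_congr rfl this, sum_ite_eq', triangleCount]
  push_cast; rfl

open Classical in
theorem totalExcess_le_deleteEdges (N : Finset V) {a b : V} (hab : a ≠ b) :
    totalExcess G N ≤ totalExcess (G.deleteEdges {s(a, b)}) N +
      2 * ((if a ∈ N ∧ b ∈ N then 1 else 0) + triangleCount G N a b + triangleCount G N b a) := by
  have e1 : ∀ a b : V, a ≠ b → (∑ i ∈ N, ∑ j ∈ N, if i = j then 0 else
      if i = a ∧ j = b then (1 : ℤ) else 0) = if a ∈ N ∧ b ∈ N then 1 else 0 := by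
    intro a b hab
    have : ∀ i ∈ N, (∑ j ∈ N, if i = j then 0 else if i = a ∧ j = b then (1 : ℤ) else 0) =
        if i = a then if b ∈ N then 1 else 0 else 0 := by
      intro i _
      by_cases h : i = a
      · subst h
        rw [if_pos rfl, ← sum_ite_eq' N b fun _ => (1 : ℤ)]
        refine sum_congr rfl fun j _ => ?_
        by_cases h2 : j = b
        · subst h2; simp [hab]
        · simp [h2]
      · simp [h]
    rw [sum_congr rfl this, sum_ite_eq']
    split_ifs <;> tauto
  have hle : totalExcess G N ≤ ∑ i ∈ N, ∑ j ∈ N,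
      ((if i = j then 0 else excess (G.deleteEdges {s(a, b)}) i j) +
      ((if i = j then 0 else if i = a ∧ j = b then 1 else 0) +
      (if i = j then 0 else if i = b ∧ j = a then 1 else 0) +
      (if i = j then 0 else if i = a ∧ j ≠ b ∧ G.Adj b j then 1 else 0) +
      (if i = j then 0 else if i = b ∧ j ≠ a ∧ G.Adj a j then 1 else 0) +
      (if i = j then 0 else if j = a ∧ i ≠ b ∧ G.Adj b i then 1 else 0) +
      (if i = j then 0 else if j = b ∧ i ≠ a ∧ G.Adj a i then 1 else 0))) := by
    refine sum_le_sum fun i _ => sum_le_sum fun j _ => ?_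
    by_cases h : i = j
    · simp [h]
    · simp only [h, if_false]
      linarith [excess_le_deleteEdges (G := G) a b i j]
  refine hle.trans (le_of_eq ?_)
  have swap : ∀ a b : V, a ≠ b → (∑ i ∈ N, ∑ j ∈ N, if i = j then 0 else
      if j = a ∧ i ≠ b ∧ G.Adj b i then (1 : ℤ) else 0) = triangleCount G N a b := by
    intro a b hab
    rw [sum_comm, ← sum_triangle N a b hab]
    simp only [eq_comm]
  simp only [sum_add_distrib]
  rw [e1 a b hab, e1 b a hab.symm, sum_triangle N a b hab, sum_triangle N b a hab.symm,
    swap a b hab, swap b a hab.symm, totalExcess]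
  simp only [and_comm (a := b ∈ N)]
  ring

theorem triangleCount_le {N : Finset V} {a b : V} (hab : a ≠ b) (ha : a ∈ N) (hb : b ∈ N) :
    triangleCount G N a b + 2 ≤ #N := by
  classical
  rw [triangleCount, if_pos ha]
  have : #{y ∈ N | y ≠ a ∧ y ≠ b ∧ G.Adj b y} ≤ #((N.erase a).erase b) := by
    refine card_le_card fun y hy => ?_
    simp only [mem_filter, mem_erase] at hy ⊢
    tauto
  rw [card_erase_of_mem (mem_erase.2 ⟨hab.symm, hb⟩), card_erase_of_mem ha] at this
  have h2 : 2 ≤ #N := by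
    rw [← card_pair hab]
    exact card_le_card (by simp [insert_subset_iff, ha, hb])
  omega

theorem adj_of_triangleCount_eq {N : Finset V} {a b : V} (hab : a ≠ b) (ha : a ∈ N) (hb : b ∈ N)
    (h : #N ≤ triangleCount G N a b + 2) {y : V} (hy : y ∈ N) (hya : y ≠ a) (hyb : y ≠ b) :
    G.Adj b y := by
  classical
  by_contra hn
  rw [triangleCount, if_pos ha] at h
  have : #{y ∈ N | y ≠ a ∧ y ≠ b ∧ G.Adj b y} ≤ #(((N.erase a).erase b).erase y) := by
    refine card_le_card fun z hz => ?_
    simp only [mem_filter, mem_erase] at hz ⊢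
    refine ⟨?_, hz.2.2.1, hz.2.1, hz.1⟩
    rintro rfl
    exact hn hz.2.2.2
  have h3 : #{y, a, b} ≤ #N := card_le_card (by simp [insert_subset_iff, ha, hb, hy])
  rw [card_insert_of_notMem (by simp [hya, hyb]), card_pair hab] at h3
  rw [card_erase_of_mem (by simp [hya, hyb, hy]),
    card_erase_of_mem (mem_erase.2 ⟨hab.symm, hb⟩), card_erase_of_mem ha] at this
  omega

theorem triangleCount_lt {N : Finset V} {a b : V} (ha : a ∈ N) :
    triangleCount G N a b < #N := by
  classical
  rw [triangleCount, if_pos ha]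
  refine card_lt_card (filter_ssubset.2 ⟨a, ha, by simp⟩)

theorem triangleCount_of_notMem {N : Finset V} {a b : V} (ha : a ∉ N) :
    triangleCount G N a b = 0 := by
  rw [triangleCount, if_neg ha]

/-- Deleting an edge decreases the total excess by at most `2 * (2 * #N - 3)`. -/
theorem totalExcess_le_deleteEdges_add {N : Finset V} (hN : 2 ≤ #N) {a b : V} (hab : a ≠ b) :
    totalExcess G N ≤ totalExcess (G.deleteEdges {s(a, b)}) N + 2 * (2 * #N - 3) := by
  have h := totalExcess_le_deleteEdges (G := G) N hab
  -- With both ends in `N` the loss is at most 2(1 + 2(#N - 2)) = 2(2#N - 3); with one end it is at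
  -- most 2(#N - 1), which is no larger since #N ≥ 2; otherwise it is 0.
  by_cases ha : a ∈ N <;> by_cases hb : b ∈ N
  · have h1 := triangleCount_le (G := G) hab ha hb
    have h2 := triangleCount_le (G := G) hab.symm hb ha
    simp only [ha, hb, and_self, if_true] at h
    omega
  · have h1 := triangleCount_lt (G := G) (b := b) ha
    have h2 := triangleCount_of_notMem (G := G) (b := a) hb
    simp only [hb, and_false, if_false] at h
    omega
  · have h1 := triangleCount_lt (G := G) (b := a) hb
    have h2 := triangleCount_of_notMem (G := G) (b := b) ha
    simp only [ha, false_and, if_false] at h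
    omega
  · have h1 := triangleCount_of_notMem (G := G) (b := a) hb
    have h2 := triangleCount_of_notMem (G := G) (b := b) ha
    simp only [ha, false_and, if_false] at h
    omega

/-- For #N ≥ 3 one has #N - 1 < 2#N - 3, so maximal loss requires both ends in `N` and both triangle
counts equal to #N - 2. -/
theorem adj_of_totalExcess_eq {N : Finset V} (hN : 3 ≤ #N) {a b : V} (hab : a ≠ b)
    (h : totalExcess (G.deleteEdges {s(a, b)}) N + 2 * (2 * #N - 3) ≤ totalExcess G N) :
    a ∈ N ∧ b ∈ N ∧ ∀ y ∈ N, y ≠ a → y ≠ b → G.Adj a y ∧ G.Adj b y := by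
  have h := h.trans (totalExcess_le_deleteEdges (G := G) N hab)
  by_cases ha : a ∈ N <;> by_cases hb : b ∈ N
  · have h1 := triangleCount_le (G := G) hab ha hb
    have h2 := triangleCount_le (G := G) hab.symm hb ha
    simp only [ha, hb, and_self, if_true] at h
    exact ⟨ha, hb, fun y hy hya hyb =>
      ⟨adj_of_triangleCount_eq hab.symm hb ha (by omega) hy hyb hya,
        adj_of_triangleCount_eq hab ha hb (by omega) hy hya hyb⟩⟩
  · have h1 := triangleCount_lt (G := G) (b := b) ha
    have h2 := triangleCount_of_notMem (G := G) (b := a) hb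
    simp only [hb, and_false, if_false] at h
    omega
  · have h1 := triangleCount_lt (G := G) (b := a) hb
    have h2 := triangleCount_of_notMem (G := G) (b := b) ha
    simp only [ha, false_and, if_false] at h
    omega
  · have h1 := triangleCount_of_notMem (G := G) (b := a) hb
    have h2 := triangleCount_of_notMem (G := G) (b := b) ha
    simp only [ha, false_and, if_false] at h
    omega

theorem SimpleGraph.IsTree.totalExcess_eq_zero (h : G.IsTree) (N : Finset V) :
    totalExcess G N = 0 :=
  sum_eq_zero fun i _ => sum_eq_zero fun j _ => by
    split_ifs with hij
    · rfl
    · exact h.excess_eq_zero hij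

theorem SimpleGraph.Connected.exists_adj_connected_deleteEdges (h : G.Connected)
    (hG : ¬ G.IsTree) : ∃ a b, G.Adj a b ∧ (G.deleteEdges {s(a, b)}).Connected := by
  have : ¬ G.IsAcyclic := fun h' => hG ⟨h, h'⟩
  rw [SimpleGraph.isAcyclic_iff_forall_adj_isBridge] at this
  push Not at this
  obtain ⟨a, b, hab, hb⟩ := this
  exact ⟨a, b, hab, h.connected_delete_edge_of_not_isBridge hb⟩

/-- The total excess is bounded in terms of the cyclomatic number. -/
theorem SimpleGraph.Connected.totalExcess_le (h : G.Connected) {N : Finset V} (hN : 2 ≤ #N) :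
    totalExcess G N ≤ (2 * #N - 3) * cyc2 G := by
  -- Deleting a non-bridge lowers `cyc2` by 2 and the excess by at most 2(2#N - 3), and trees have
  -- excess 0.
  obtain ⟨m, hm, hm0⟩ := h.exists_cyc2_eq
  induction m generalizing G with
  | zero => rw [(hm0.1 rfl).totalExcess_eq_zero, hm]; simp
  | succ m ih =>
    obtain ⟨a, b, hab, hc⟩ := h.exists_adj_connected_deleteEdges (by simp [← hm0])
    have hcyc := cyc2_deleteEdges hab
    obtain ⟨m', hm', hm0'⟩ := hc.exists_cyc2_eq
    have : m' = m := by push_cast at hm; omega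
    subst this
    have h1 := ih hc hm' hm0'
    have h2 := totalExcess_le_deleteEdges_add (G := G) hN hab.ne
    rw [hcyc] at h1
    linarith

end Excess

/-! ### Deleting a vertex -/

section Neighbourhood

variable {V : Type} [Fintype V]

/-- The number of neighbours of `w` in `N`. -/
noncomputable def nbrsIn (G : SimpleGraph V) (N : Finset V) (w : V) : ℤ := ∑ u ∈ N, adjInd G u w

open Classical in
/-- The indicator of the vertices which neither belong to `N` nor have a neighbour in `N`. -/
noncomputable def remoteInd (G : SimpleGraph V) (N : Finset V) (w : V) : ℤ :=
  if w ∉ N ∧ nbrsIn G N w = 0 then 1 else 0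

open Classical in
/-- The number of ordered pairs in `N` of distinct, non-adjacent vertices without common
neighbour. -/
noncomputable def farPairs (G : SimpleGraph V) (N : Finset V) : ℤ :=
  ∑ i ∈ N, ∑ j ∈ N, if i = j then 0 else farInd G i j

open Classical in
/-- The sum of the numbers of neighbours in `N`, each decreased by one at the vertices outside `N`
that have such neighbours. -/
noncomputable def linkSum (G : SimpleGraph V) (N : Finset V) : ℤ :=
  ∑ w, (nbrsIn G N w - 1 + (if w ∈ N then 1 else 0) + remoteInd G N w)

variable {G : SimpleGraph V}

omit [Fintype V] in
theorem nbrsIn_eq_zero_iff {N : Finset V} {w : V} : nbrsIn G N w = 0 ↔ ∀ u ∈ N, ¬ G.Adj u w := by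
  unfold nbrsIn
  rw [sum_eq_zero_iff_of_nonneg fun _ _ => adjInd_nonneg _ _ _]
  simp [adjInd]

omit [Fintype V] in
theorem SimpleGraph.Connected.exists_adj_dist_lt (h : G.Connected) {r w : V} (hw : w ≠ r) :
    ∃ u, G.Adj w u ∧ G.dist u r < G.dist w r := by
  obtain ⟨p, hp⟩ := h.exists_walk_length_eq_dist w r
  cases p with
  | nil => exact absurd rfl hw
  | cons hadj q =>
    refine ⟨_, hadj, ?_⟩
    rw [← hp, SimpleGraph.Walk.length_cons]
    exact Nat.lt_succ_of_le (SimpleGraph.dist_le q)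

open Classical in
-- Fix r in `N` and send each remote vertex to its next vertex on a shortest path to r. That vertex
-- is outside `N`, so every remote vertex owns an edge avoiding `N`, counted here in both
-- orientations.
theorem SimpleGraph.Connected.two_mul_sum_remoteInd_le (h : G.Connected) {N : Finset V}
    (hN : N.Nonempty) :
    2 * ∑ w, remoteInd G N w ≤ ∑ u ∈ Nᶜ, ∑ w ∈ Nᶜ, adjInd G u w := by
  obtain ⟨r, hr⟩ := hN
  set F : Finset V := {w | w ∉ N ∧ nbrsIn G N w = 0} with hF
  have hp : ∀ w, ∃ u, w ≠ r → G.Adj w u ∧ G.dist u r < G.dist w r := by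
    intro w
    by_cases hw : w = r
    · exact ⟨w, fun h => absurd hw h⟩
    · obtain ⟨u, hu⟩ := h.exists_adj_dist_lt hw
      exact ⟨u, fun _ => hu⟩
  choose p hp using hp
  have hFp : ∀ w ∈ F, w ∉ N ∧ p w ∉ N ∧ G.Adj w (p w) ∧ G.dist (p w) r < G.dist w r := by
    intro w hw
    rw [hF, mem_filter, nbrsIn_eq_zero_iff] at hw
    have hwr : w ≠ r := fun e => hw.2.1 (e ▸ hr)
    exact ⟨hw.2.1, fun hn => hw.2.2 _ hn (hp w hwr).1.symm, hp w hwr⟩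
  -- The distance to `r` strictly decreases from w to `p w`, so no edge is owned by both of its
  -- ends.
  have hdisj : Disjoint (F.image fun w => (w, p w)) (F.image fun w => (p w, w)) := by
    rw [Finset.disjoint_left]
    rintro _ h1 h2
    obtain ⟨w, hw, rfl⟩ := mem_image.1 h1
    obtain ⟨w', hw', e⟩ := mem_image.1 h2
    simp only [Prod.mk.injEq] at e
    have a1 := (hFp w hw).2.2.2
    have a2 := (hFp w' hw').2.2.2
    rw [e.1, e.2] at a2
    omega
  have hsub : (F.image fun w => (w, p w)) ∪ (F.image fun w => (p w, w)) ⊆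
      (Nᶜ ×ˢ Nᶜ).filter fun q => G.Adj q.1 q.2 := by
    intro q hq
    rcases mem_union.1 hq with hq | hq <;> obtain ⟨w, hw, rfl⟩ := mem_image.1 hq <;>
      obtain ⟨h1, h2, h3, -⟩ := hFp w hw
    · simp [h1, h2, h3]
    · simp [h1, h2, h3.symm]
  have hcard := card_le_card hsub
  rw [card_union_of_disjoint hdisj,
    card_image_of_injective _ (fun a b e => (Prod.mk.inj e).1),
    card_image_of_injective _ (fun a b e => (Prod.mk.inj e).2)] at hcard
  have e1 : ∑ w, remoteInd G N w = #F := by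
    rw [hF, card_filter]; push_cast; rfl
  have e2 : ∑ u ∈ Nᶜ, ∑ w ∈ Nᶜ, adjInd G u w =
      #((Nᶜ ×ˢ Nᶜ).filter fun q => G.Adj q.1 q.2) := by
    rw [card_filter, sum_product]; push_cast; rfl
  rw [e1, e2]
  exact_mod_cast (by omega : 2 * #F ≤ _)

open Classical in
-- Once the arcs are split according to which ends lie in `N`, the difference of the two sides is
-- the number of arcs avoiding `N` minus twice the number of remote vertices.
theorem SimpleGraph.Connected.linkSum_le (h : G.Connected) {N : Finset V} (hN : N.Nonempty) :
    2 * linkSum G N ≤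
      2 * ((#N : ℤ) - 1) + cyc2 G + ∑ i ∈ N, ∑ j ∈ N, adjInd G i j := by
  have h1 := h.two_mul_sum_remoteInd_le hN
  have e1 : arcs G = ∑ i ∈ N, ∑ j ∈ N, adjInd G i j + ∑ i ∈ N, ∑ j ∈ Nᶜ, adjInd G i j +
      (∑ i ∈ Nᶜ, ∑ j ∈ N, adjInd G i j + ∑ i ∈ Nᶜ, ∑ j ∈ Nᶜ, adjInd G i j) := by
    unfold arcs
    rw [← sum_add_sum_compl N, ← sum_add_distrib, ← sum_add_distrib]
    simp only [sum_add_sum_compl]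
  have e2 : ∑ i ∈ Nᶜ, ∑ j ∈ N, adjInd G i j = ∑ i ∈ N, ∑ j ∈ Nᶜ, adjInd G i j := by
    rw [sum_comm]
    simp only [adjInd_comm G]
  have e3 : ∑ w, nbrsIn G N w =
      ∑ i ∈ N, ∑ j ∈ N, adjInd G i j + ∑ i ∈ N, ∑ j ∈ Nᶜ, adjInd G i j := by
    unfold nbrsIn
    rw [sum_comm, ← sum_add_distrib]
    simp only [sum_add_sum_compl]
  have e4 : ∑ w : V, (if w ∈ N then (1 : ℤ) else 0) = #N := by simp
  simp only [linkSum, sum_add_distrib, sum_sub_distrib, e3, e4]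
  simp only [sum_const, card_univ, nsmul_eq_mul, mul_one]
  rw [cyc2, e1, e2]
  linarith

/-- Serves the deletion of a vertex of degree one, where the excess bound is not available. Every
summand is in fact 0. -/
theorem linkSum_singleton_le (a : V) : linkSum G {a} ≤ 0 := by
  refine sum_nonpos fun w _ => ?_
  unfold remoteInd nbrsIn
  simp only [sum_singleton, mem_singleton]
  by_cases h : w = a
  · simp [h]
  · rcases adjInd_eq_zero_or_one G a w with h1 | h1 <;> simp [h, h1]

end Neighbourhood

/-! ### The change of the form when a vertex is deleted -/

section DeleteVertex

set_option linter.unusedSectionVars false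

variable {V : Type} [Fintype V] {G : SimpleGraph V} {v : V} [Fintype {w | w ≠ v}]

open Classical in
/-- The neighbours of `v`, as vertices of the graph obtained by deleting `v`. -/
noncomputable def nbrs (G : SimpleGraph V) (v : V) [Fintype {w | w ≠ v}] :
    Finset {w | w ≠ v} := {w | G.Adj v w}

theorem mem_nbrs {w : {w | w ≠ v}} : w ∈ nbrs G v ↔ G.Adj v w := by simp [nbrs]

theorem sum_eq_add_sum_ne (f : V → ℤ) : ∑ x, f x = f v + ∑ x : {w | w ≠ v}, f x := by
  classical
  convert Fintype.sum_eq_add_sum_subtype_ne f v using 3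
  ext x
  simp

theorem adjInd_induce (i j : {w | w ≠ v}) :
    adjInd (G.induce {w | w ≠ v}) i j = adjInd G i j := rfl

open Classical in
theorem adjInd_eq_ite_mem_nbrs (i : {w | w ≠ v}) :
    adjInd G v i = if i ∈ nbrs G v then 1 else 0 := by
  simp only [mem_nbrs, adjInd]

open Classical in
theorem codeg_eq_induce (i j : {w | w ≠ v}) :
    codeg G i j = codeg (G.induce {w | w ≠ v}) i j +
      (if i ∈ nbrs G v then 1 else 0) * (if j ∈ nbrs G v then 1 else 0) := by
  unfold codeg
  rw [sum_eq_add_sum_ne (v := v), adjInd_comm G i v, adjInd_eq_ite_mem_nbrs,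
    adjInd_eq_ite_mem_nbrs, add_comm]
  rfl

theorem codeg_eq_nbrsIn (j : {w | w ≠ v}) :
    codeg G v j = nbrsIn (G.induce {w | w ≠ v}) (nbrs G v) j := by
  classical
  unfold codeg nbrsIn
  rw [sum_eq_add_sum_ne (v := v), adjInd_self, zero_mul, zero_add,
    ← sum_ite_mem_eq (nbrs G v)]
  refine sum_congr rfl fun x _ => ?_
  rw [adjInd_eq_ite_mem_nbrs, adjInd_induce]
  split_ifs <;> simp

theorem farInd_eq_remoteInd (j : {w | w ≠ v}) :
    farInd G v j = remoteInd (G.induce {w | w ≠ v}) (nbrs G v) j := by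
  have h : (¬ G.Adj v j ∧ codeg G v j = 0) ↔
      (j ∉ nbrs G v ∧ nbrsIn (G.induce {w | w ≠ v}) (nbrs G v) j = 0) := by
    rw [codeg_eq_nbrsIn, mem_nbrs]
  unfold farInd remoteInd
  split_ifs <;> tauto

open Classical in
-- Only pairs inside the neighbourhood of `v` are affected: they gain the common neighbour `v`,
-- which adds 2t + 4 to t² + 3t, and they are no longer far.
theorem pairWeight_induce (i j : {w | w ≠ v}) :
    pairWeight G i j = pairWeight (G.induce {w | w ≠ v}) i j +
      (if i ∈ nbrs G v then if j ∈ nbrs G v then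
        2 * codeg (G.induce {w | w ≠ v}) i j + 4 - 4 * farInd (G.induce {w | w ≠ v}) i j
        else 0 else 0) := by
  have h0 := codeg_nonneg (G.induce {w | w ≠ v}) i j
  unfold pairWeight farInd
  rw [codeg_eq_induce, adjInd_induce]
  have hadj : (G.induce {w | w ≠ v}).Adj i j ↔ G.Adj i j := Iff.rfl
  rw [hadj]
  by_cases hi : i ∈ nbrs G v
  · by_cases hj : j ∈ nbrs G v
    · simp only [hi, hj, if_true, mul_one]
      rw [if_neg (by omega)]
      ring
    · simp [hj]
  · simp [hi]

theorem pairWeight_self_left (j : {w | w ≠ v}) :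
    pairWeight G v j = nbrsIn (G.induce {w | w ≠ v}) (nbrs G v) j ^ 2 +
      3 * nbrsIn (G.induce {w | w ≠ v}) (nbrs G v) j -
      4 * (1 - adjInd G v j - remoteInd (G.induce {w | w ≠ v}) (nbrs G v) j) := by
  rw [pairWeight, codeg_eq_nbrsIn, farInd_eq_remoteInd]

open Classical in
-- Double counting of the triples (i, w, j) with i, j in `N` both adjacent to w; those with i = j
-- give the linear term.
theorem sum_nbrsIn_sq {U : Type} [Fintype U] (H : SimpleGraph U) (N : Finset U) :
    ∑ w, nbrsIn H N w ^ 2 =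
      ∑ w, nbrsIn H N w + ∑ i ∈ N, ∑ j ∈ N, if i = j then 0 else codeg H i j := by
  have e1 : ∑ w, nbrsIn H N w ^ 2 = ∑ i ∈ N, ∑ j ∈ N, codeg H i j := by
    simp only [nbrsIn, sq, sum_mul_sum, codeg]
    rw [sum_comm]
    refine sum_congr rfl fun i _ => ?_
    rw [sum_comm]
    simp only [adjInd_comm H _ _]
  have e2 : ∑ w, nbrsIn H N w = ∑ i ∈ N, ∑ j ∈ N, if i = j then codeg H i j else 0 := by
    unfold nbrsIn
    rw [sum_comm]
    refine sum_congr rfl fun i hi => ?_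
    rw [sum_ite_eq, if_pos hi, codeg]
    refine sum_congr rfl fun x _ => ?_
    rw [adjInd_comm H x i, adjInd_mul_self]
  rw [e1, e2, ← sum_add_distrib]
  refine sum_congr rfl fun i _ => ?_
  rw [← sum_add_distrib]
  refine sum_congr rfl fun j _ => ?_
  split_ifs <;> simp

theorem arcs_eq_induce :
    arcs G = arcs (G.induce {w | w ≠ v}) + 2 * #(nbrs G v) := by
  classical
  unfold arcs
  have hd : ∑ j : {w | w ≠ v}, adjInd G v j = #(nbrs G v) := by
    simp only [adjInd_eq_ite_mem_nbrs]
    simp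
  simp only [sum_eq_add_sum_ne (v := v), adjInd_self, zero_add, sum_add_distrib,
    fun i => adjInd_comm G i v, hd]
  simp only [adjInd_induce]
  ring

omit [Fintype {w | w ≠ v}] in
theorem card_eq_card_ne [Fintype {w | w ≠ v}] :
    (Fintype.card V : ℤ) = Fintype.card {w | w ≠ v} + 1 := by
  have := sum_eq_add_sum_ne (v := v) fun _ => 1
  simp only [sum_const, card_univ, nsmul_eq_mul, mul_one] at this
  linarith

theorem cyc2_eq_induce :
    cyc2 G = cyc2 (G.induce {w | w ≠ v}) + 2 * ((#(nbrs G v) : ℤ) - 1) := by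
  rw [cyc2, cyc2, arcs_eq_induce (v := v), card_eq_card_ne (v := v)]
  ring

open Classical in
-- The change is grouped so that each bracket is nonnegative when the smaller graph is connected and
-- `v` has at least two neighbours: the brackets are the slacks of `totalExcess_le` and
-- `linkSum_le`, and a count of far pairs.
theorem gammaForm_eq_induce :
    gammaForm G = gammaForm (G.induce {w | w ≠ v}) +
      4 * ((2 * #(nbrs G v) - 3) * cyc2 (G.induce {w | w ≠ v}) -
        totalExcess (G.induce {w | w ≠ v}) (nbrs G v)) +
      4 * (2 * ((#(nbrs G v) : ℤ) - 1) + cyc2 (G.induce {w | w ≠ v}) +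
        ∑ i ∈ nbrs G v, ∑ j ∈ nbrs G v, adjInd (G.induce {w | w ≠ v}) i j -
        2 * linkSum (G.induce {w | w ≠ v}) (nbrs G v)) +
      8 * farPairs (G.induce {w | w ≠ v}) (nbrs G v) := by
  set H := G.induce {w | w ≠ v} with hH
  set N := nbrs G v with hN
  have e1 : totalWeight G = totalWeight H +
      (∑ i ∈ N, ∑ j ∈ N, if i = j then 0 else 2 * codeg H i j + 4 - 4 * farInd H i j) +
      2 * ∑ j : {w | w ≠ v}, pairWeight G v j := by
    unfold totalWeight
    have ne1 : ∀ x : {w | w ≠ v}, ((x : V) = v) = False := fun x => eq_false x.2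
    have ne2 : ∀ x : {w | w ≠ v}, (v = (x : V)) = False := fun x => eq_false (Ne.symm x.2)
    simp only [sum_eq_add_sum_ne (v := v), if_true, zero_add, sum_add_distrib, ne1, ne2, if_false,
      Subtype.coe_inj, pairWeight_comm G _ v]
    have : ∑ i : {w | w ≠ v}, ∑ j : {w | w ≠ v}, (if i = j then 0 else pairWeight G i j) =
      (∑ i, ∑ j, if i = j then 0 else pairWeight H i j) +
      (∑ i ∈ N, ∑ j ∈ N, if i = j then 0 else 2 * codeg H i j + 4 - 4 * farInd H i j) := by
      rw [← sum_ite_mem_eq N, ← sum_add_distrib]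
      refine sum_congr rfl fun i _ => ?_
      have : (if i ∈ N then ∑ j ∈ N, if i = j then 0 else 2 * codeg H i j + 4 - 4 * farInd H i j
          else 0) = ∑ j, if i ∈ N then if j ∈ N then
            if i = j then 0 else 2 * codeg H i j + 4 - 4 * farInd H i j else 0 else 0 := by
        split_ifs
        · rw [sum_ite_mem_eq]
        · simp
      rw [this, ← sum_add_distrib]
      refine sum_congr rfl fun j _ => ?_
      rw [pairWeight_induce, ← hH, ← hN]
      split_ifs <;> simp
    rw [this]
    ring_nf
  have e2 : ∑ j : {w | w ≠ v}, pairWeight G v j =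
      (∑ i ∈ N, ∑ j ∈ N, if i = j then 0 else codeg H i j) +
      4 * linkSum H N := by
    have := sum_nbrsIn_sq H N
    simp only [linkSum, pairWeight_self_left, sum_add_distrib, sum_sub_distrib, ← mul_sum, adjInd_eq_ite_mem_nbrs]
    rw [← hH, ← hN, this]
    ring_nf
  -- For each pair this reads 4 codeg + 4 - 4 far = 4 excess + 8 - 4 adj - 8 far. The second sum
  -- comes from the squares in the weights of the pairs containing `v`.
  have e3 : (∑ i ∈ N, ∑ j ∈ N, if i = j then 0 else 2 * codeg H i j + 4 - 4 * farInd H i j) +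
      2 * (∑ i ∈ N, ∑ j ∈ N, if i = j then 0 else codeg H i j) =
      4 * totalExcess H N + 8 * (#N * (#N - 1)) - 4 * (∑ i ∈ N, ∑ j ∈ N, adjInd H i j) -
        8 * farPairs H N := by
    have e4 : (#N * (#N - 1) : ℤ) = ∑ i ∈ N, ∑ j ∈ N, if i = j then (0 : ℤ) else 1 := by
      have : ∀ i ∈ N, (∑ j ∈ N, if i = j then (0 : ℤ) else 1) = #N - 1 := by
        intro i hi
        have : ∀ j, (if i = j then (0 : ℤ) else 1) = 1 - if i = j then 1 else 0 := by
          intro j; split_ifs <;> simp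
        simp only [this, sum_sub_distrib, sum_ite_eq, hi, if_true]
        simp
      rw [sum_congr rfl this]
      simp [mul_sub]
    rw [e4, totalExcess, farPairs]
    simp only [mul_sum, ← sum_add_distrib, ← sum_sub_distrib]
    refine sum_congr rfl fun i _ => sum_congr rfl fun j _ => ?_
    split_ifs with h
    · simp [h]
    · unfold excess; ring
  have e5 := cyc2_eq_induce (G := G) (v := v)
  rw [← hH, ← hN] at e5
  unfold gammaForm
  rw [e1, e2, e5]
  linear_combination -e3

end DeleteVertex

/-! ### Nonnegativity of the form, and the consequences of its vanishing -/

section Nonneg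

variable {V : Type} [Fintype V] {G : SimpleGraph V}

theorem totalExcess_singleton [DecidableEq V] (a : V) : totalExcess G {a} = 0 := by
  simp [totalExcess]

theorem farPairs_nonneg (N : Finset V) : 0 ≤ farPairs G N :=
  sum_nonneg fun i _ => sum_nonneg fun j _ => by
    split_ifs
    · exact le_rfl
    · exact farInd_nonneg G i j

theorem farPairs_eq_zero {N : Finset V} (h : farPairs G N = 0) {i j : V} (hi : i ∈ N) (hj : j ∈ N)
    (hij : i ≠ j) : G.Adj i j ∨ ∃ x, G.Adj i x ∧ G.Adj x j := by
  have hnn : ∀ i j : V, 0 ≤ (open Classical in if i = j then 0 else farInd G i j) := by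
    intro i j
    split_ifs
    · exact le_rfl
    · exact farInd_nonneg G i j
  have h1 := (sum_eq_zero_iff_of_nonneg fun i _ => sum_nonneg fun j _ => hnn i j).1 h i hi
  have h2 := (sum_eq_zero_iff_of_nonneg fun j _ => hnn i j).1 h1 j hj
  rw [if_neg hij] at h2
  by_contra hcon
  push Not at hcon
  have : codeg G i j = 0 := (codeg_eq_zero_iff G).2 fun x hx => hcon.2 x hx.1 hx.2
  simp [farInd, hcon.1, this] at h2

theorem gammaForm_induce_le {v : V} [Fintype {w | w ≠ v}]
    (hH : (G.induce {w | w ≠ v}).Connected) (hN : (nbrs G v).Nonempty) :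
    gammaForm (G.induce {w | w ≠ v}) ≤ gammaForm G := by
  classical
  have h := gammaForm_eq_induce (G := G) (v := v)
  have hfar := farPairs_nonneg (G := G.induce {w | w ≠ v}) (nbrs G v)
  -- With a single neighbour the coefficient 2k - 3 is -1, and the resulting -`cyc2` cancels the
  -- +`cyc2` in the next bracket.
  rcases Nat.lt_or_ge #(nbrs G v) 2 with h2 | h2
  · obtain ⟨a, ha⟩ := card_eq_one.1 (by have := hN.card_pos; omega : #(nbrs G v) = 1)
    rw [ha] at h hfar
    have h1 := linkSum_singleton_le (G := G.induce {w | w ≠ v}) a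
    rw [totalExcess_singleton, card_singleton] at h
    simp only [sum_singleton, adjInd_self] at h
    push_cast at h
    linarith
  · have h3 := hH.totalExcess_le h2
    have h4 := hH.linkSum_le hN
    linarith

/-- The form of `G` is a sum of nonnegative terms, so all vanish; the two equalities needed later
are recorded. -/
theorem eq_of_gammaForm_eq_zero {v : V} [Fintype {w | w ≠ v}]
    (hH : (G.induce {w | w ≠ v}).Connected) (h2 : 2 ≤ #(nbrs G v))
    (h0 : 0 ≤ gammaForm (G.induce {w | w ≠ v})) (hG : gammaForm G = 0) :
    totalExcess (G.induce {w | w ≠ v}) (nbrs G v) =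
      (2 * #(nbrs G v) - 3) * cyc2 (G.induce {w | w ≠ v}) ∧
    farPairs (G.induce {w | w ≠ v}) (nbrs G v) = 0 := by
  classical
  have h := gammaForm_eq_induce (G := G) (v := v)
  have hfar := farPairs_nonneg (G := G.induce {w | w ≠ v}) (nbrs G v)
  have h3 := hH.totalExcess_le h2
  have h4 := hH.linkSum_le (card_pos.1 (by omega : 0 < #(nbrs G v)))
  constructor <;> linarith

theorem SimpleGraph.Connected.nbrs_nonempty [Nontrivial V] (h : G.Connected) (v : V)
    [Fintype {w | w ≠ v}] : (nbrs G v).Nonempty := by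
  obtain ⟨u, hu⟩ := h.preconnected.exists_adj_of_nontrivial v
  exact ⟨⟨u, hu.ne'⟩, mem_nbrs.2 hu⟩

/-- The form is nonnegative on connected graphs. -/
theorem SimpleGraph.Connected.gammaForm_nonneg (h : G.Connected) : 0 ≤ gammaForm G := by
  classical
  obtain ⟨n, hn⟩ : ∃ n, n = Fintype.card V := ⟨_, rfl⟩
  induction n generalizing V with
  | zero =>
    have := h.nonempty
    exact absurd hn Fintype.card_ne_zero.symm
  | succ n ih =>
    rcases subsingleton_or_nontrivial V with hs | hs
    · have e1 : totalWeight G = 0 :=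
        sum_eq_zero fun i _ => sum_eq_zero fun j _ => if_pos (Subsingleton.elim i j)
      have e2 : cyc2 G = 0 := by
        have : arcs G = 0 := sum_eq_zero fun i _ => sum_eq_zero fun j _ => by
          rw [Subsingleton.elim i j, adjInd_self]
        have := h.nonempty
        have : Fintype.card V = 1 :=
          le_antisymm (Fintype.card_le_one_iff_subsingleton.2 hs) Fintype.card_pos
        simp [cyc2, *]
      simp [gammaForm, e1, e2]
    -- Induction through a vertex whose deletion leaves the graph connected.
    · obtain ⟨v, hv⟩ := h.exists_connected_induce_compl_singleton_of_finite_nontrivial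
      have hv : (G.induce {w | w ≠ v}).Connected := hv
      refine le_trans (ih hv ?_) (gammaForm_induce_le hv (h.nbrs_nonempty v))
      have := card_eq_card_ne (v := v)
      omega

end Nonneg

/-! ### Equality in the excess bound -/

section Tight

variable {U : Type} [Fintype U] {H : SimpleGraph U} {N : Finset U}

/-- In a graph attaining the bound `SimpleGraph.Connected.totalExcess_le`, every edge whose
deletion leaves the graph connected joins two elements of `N`, and is contained in triangles with
all the other elements of `N`. -/
theorem SimpleGraph.Connected.adj_of_totalExcess_eq (hN : 3 ≤ #N)
    (ht : totalExcess H N = (2 * #N - 3) * cyc2 H) {a b : U} (hab : H.Adj a b)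
    (hc : (H.deleteEdges {s(a, b)}).Connected) :
    totalExcess (H.deleteEdges {s(a, b)}) N = (2 * #N - 3) * cyc2 (H.deleteEdges {s(a, b)}) ∧
    a ∈ N ∧ b ∈ N ∧ ∀ y ∈ N, y ≠ a → y ≠ b → H.Adj a y ∧ H.Adj b y := by
  have h1 := hc.totalExcess_le (by omega : 2 ≤ #N)
  have h2 := totalExcess_le_deleteEdges_add (G := H) (by omega : 2 ≤ #N) hab.ne
  have h3 := cyc2_deleteEdges hab
  rw [h3] at h1 ⊢
  -- The bound for the smaller graph and equality for `H` force the maximal loss, so equality passes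
  -- to the smaller graph as well.
  refine ⟨by linarith, _root_.adj_of_totalExcess_eq hN hab.ne ?_⟩
  linarith

omit [Fintype U] in
theorem SimpleGraph.Connected.connected_deleteEdges_of_triangle (h : H.Connected) {a b c : U}
    (hac : H.Adj a c) (hcb : H.Adj c b) (hab : a ≠ b) : (H.deleteEdges {s(a, b)}).Connected := by
  refine h.connected_delete_edge_of_not_isBridge ?_
  rw [SimpleGraph.isBridge_iff, not_not]
  have h1 : (H.deleteEdges {s(a, b)}).Adj a c := by
    simp [SimpleGraph.deleteEdges_adj, hac, hac.ne', hcb.ne, hab]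
  have h2 : (H.deleteEdges {s(a, b)}).Adj c b := by
    simp [SimpleGraph.deleteEdges_adj, hcb, hac.ne', hcb.ne]
  exact h1.reachable.trans h2.reachable

/-- A graph attaining the bound `SimpleGraph.Connected.totalExcess_le` has at most one cycle. -/
theorem SimpleGraph.Connected.isTree_deleteEdges_of_totalExcess_eq (hN : 3 ≤ #N)
    (ht : totalExcess H N = (2 * #N - 3) * cyc2 H) {a b : U} (hab : H.Adj a b)
    (hc : (H.deleteEdges {s(a, b)}).Connected) : (H.deleteEdges {s(a, b)}).IsTree := by
  obtain ⟨ht', ha, hb, -⟩ := SimpleGraph.Connected.adj_of_totalExcess_eq hN ht hab hc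
  by_contra hT
  set H' := H.deleteEdges {s(a, b)} with hH'
  have hnadj : ¬ H'.Adj a b := by simp [hH', SimpleGraph.deleteEdges_adj]
  obtain ⟨p, q, hpq, hc'⟩ := hc.exists_adj_connected_deleteEdges hT
  obtain ⟨-, hp, hq, hy⟩ := SimpleGraph.Connected.adj_of_totalExcess_eq hN ht' hpq hc'
  -- An end of pq equal to `a` or `b` would be adjacent in `H'` to the other of the two, but ab has
  -- been deleted. So pq and ab are disjoint.
  have ne : ∀ p q, H'.Adj p q → (∀ y ∈ N, y ≠ p → y ≠ q → H'.Adj p y ∧ H'.Adj q y) →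
      a ≠ p ∧ b ≠ p := by
    intro p q hpq hy
    constructor
    · rintro rfl
      by_cases hbq : b = q
      · exact hnadj (hbq ▸ hpq)
      · exact hnadj (hy b hb hab.ne' hbq).1
    · rintro rfl
      by_cases haq : a = q
      · exact hnadj (haq ▸ hpq.symm)
      · exact hnadj (hy a ha hab.ne haq).1.symm
  obtain ⟨hap, hbp⟩ := ne p q hpq hy
  obtain ⟨haq, hbq⟩ := ne q p hpq.symm fun y h1 h2 h3 => (hy y h1 h3 h2).symm
  have hpa := (hy a ha hap haq).1
  have hqa := (hy a ha hap haq).2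
  -- The edge pa lies in the triangle paq, hence is not a bridge of `H'`; tightness then makes `a`
  -- adjacent to `b` in `H'`.
  obtain ⟨-, -, -, hz⟩ := SimpleGraph.Connected.adj_of_totalExcess_eq hN ht' hpa
    (hc.connected_deleteEdges_of_triangle hpq hqa hpa.ne)
  exact hnadj (hz b hb hbp hab.ne').2

/-- If a graph attaining the bound `SimpleGraph.Connected.totalExcess_le` has a cycle, it has as
many edges as vertices, and its cycle is a triangle with vertex set `N`. -/
theorem SimpleGraph.Connected.triangle_of_totalExcess_eq (h : H.Connected) (hN : 3 ≤ #N)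
    (ht : totalExcess H N = (2 * #N - 3) * cyc2 H) (hT : ¬ H.IsTree) :
    cyc2 H = 2 ∧ #N = 3 ∧ ∀ x ∈ N, ∀ y ∈ N, x ≠ y → H.Adj x y := by
  classical
  obtain ⟨a, b, hab, hc⟩ := h.exists_adj_connected_deleteEdges hT
  obtain ⟨ht', ha, hb, hy⟩ := SimpleGraph.Connected.adj_of_totalExcess_eq hN ht hab hc
  have hT' := SimpleGraph.Connected.isTree_deleteEdges_of_totalExcess_eq hN ht hab hc
  obtain ⟨m, hm, hm0⟩ := hc.exists_cyc2_eq
  have hm1 := hm0.2 hT'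
  rw [hm1, cyc2_deleteEdges hab] at hm
  have hadj : ∀ x y, (H.deleteEdges {s(a, b)}).Adj x y ↔
      H.Adj x y ∧ ¬ ((x = a ∧ y = b) ∨ (x = b ∧ y = a)) := by
    simp [SimpleGraph.deleteEdges_adj]
  -- Two further elements of `N` would both be common neighbours of `a` and `b` in a tree.
  have huniq : ∀ y ∈ N, ∀ z ∈ N, y ≠ a → y ≠ b → z ≠ a → z ≠ b → y = z := by
    intro y hyN z hzN hya hyb hza hzb
    have h1 := hT'.excess_eq_zero hab.ne
    have h2 : codeg (H.deleteEdges {s(a, b)}) a b ≤ 1 := by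
      have := farInd_nonneg (H.deleteEdges {s(a, b)}) a b
      have := adjInd_nonneg (H.deleteEdges {s(a, b)}) a b
      unfold excess at h1
      linarith
    rw [codeg_eq_card] at h2
    norm_cast at h2
    refine card_le_one.1 h2 y ?_ z ?_
    · have := hy y hyN hya hyb
      simp only [mem_filter, mem_univ, true_and, hadj, H.adj_comm y b]
      tauto
    · have := hy z hzN hza hzb
      simp only [mem_filter, mem_univ, true_and, hadj, H.adj_comm z b]
      tauto
  refine ⟨by push_cast at hm; linarith, ?_, ?_⟩
  · refine le_antisymm ?_ hN
    have h1 : #((N.erase a).erase b) ≤ 1 := card_le_one.2 fun y hy' z hz' => by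
      simp only [mem_erase] at hy' hz'
      exact huniq y hy'.2.2 z hz'.2.2 hy'.2.1 hy'.1 hz'.2.1 hz'.1
    rw [card_erase_of_mem (mem_erase.2 ⟨hab.ne', hb⟩), card_erase_of_mem ha] at h1
    omega
  · intro x hx y hyN hxy
    by_cases hxa : x = a
    · subst hxa
      by_cases hyb : y = b
      · exact hyb ▸ hab
      · exact (hy y hyN hxy.symm hyb).1
    · by_cases hxb : x = b
      · subst hxb
        by_cases hya : y = a
        · exact hya ▸ hab.symm
        · exact (hy y hyN hya hxy.symm).2
      · have h3 := hy x hx hxa hxb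
        by_cases hya : y = a
        · exact hya ▸ h3.1.symm
        · by_cases hyb : y = b
          · exact hyb ▸ h3.2.symm
          · exact absurd (huniq x hx y hyN hxa hxb hya hyb) hxy

end Tight

/-! ### Graphs on which the form vanishes -/

section Structure

variable {V : Type} {G : SimpleGraph V}

theorem SimpleGraph.Connected.forall_mem_of_closed (h : G.Connected) {S : Set V} {x : V}
    (hx : x ∈ S) (hS : ∀ u ∈ S, ∀ w, G.Adj u w → w ∈ S) (w : V) : w ∈ S := by
  obtain ⟨p⟩ := h.preconnected x w
  induction p with
  | nil => exact hx
  | cons hadj _ ih => exact ih (hS _ hx _ hadj)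

variable [Fintype V]

open Classical in
/-- The finite set of neighbours of a vertex. -/
noncomputable def nbrFin (G : SimpleGraph V) (v : V) : Finset V := {x | G.Adj v x}

theorem mem_nbrFin {v x : V} : x ∈ nbrFin G v ↔ G.Adj v x := by simp [nbrFin]

theorem sum_adjInd (v : V) : ∑ x, adjInd G v x = #(nbrFin G v) := by
  rw [nbrFin, card_filter]; push_cast; rfl

theorem card_nbrs (v : V) [Fintype {w | w ≠ v}] : #(nbrs G v) = #(nbrFin G v) := by
  refine card_bij (fun x _ => (x : V)) (fun x hx => mem_nbrFin.2 (mem_nbrs.1 hx))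
    (fun x _ y _ => Subtype.ext) fun y hy => ?_
  have hy := mem_nbrFin.1 hy
  exact ⟨⟨y, hy.ne'⟩, mem_nbrs.2 hy, rfl⟩

theorem sum_card_nbrFin : ∑ v, (#(nbrFin G v) : ℤ) = cyc2 G + 2 * Fintype.card V - 2 := by
  rw [cyc2, arcs]
  simp only [sum_adjInd]
  ring

/-- Every vertex other than `v` and `z` is adjacent to both `v` and `z`, and to no other vertex. -/
def IsBook (G : SimpleGraph V) (v z : V) : Prop :=
  v ≠ z ∧ ∀ x, x ≠ v → x ≠ z → (G.Adj v x ∧ G.Adj z x) ∧ ∀ y, y ≠ v → y ≠ z → ¬ G.Adj x y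

/-- A tree with at least three vertices, any two leaves of which have a common neighbour or are
adjacent, is a star. -/
theorem SimpleGraph.IsTree.exists_star (h : G.IsTree) (hV : 3 ≤ Fintype.card V)
    (hL : ∀ x y, #(nbrFin G x) = 1 → #(nbrFin G y) = 1 → x ≠ y →
      G.Adj x y ∨ ∃ w, G.Adj x w ∧ G.Adj w y) :
    ∃ z, ∀ x, x ≠ z → #(nbrFin G x) = 1 ∧ G.Adj x z := by
  classical
  have hc := h.connected
  have : Nontrivial V := Fintype.one_lt_card_iff_nontrivial.1 (by omega)
  have hpos : ∀ x, 1 ≤ #(nbrFin G x) := fun x => by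
    obtain ⟨u, hu⟩ := hc.preconnected.exists_adj_of_nontrivial x
    exact card_pos.2 ⟨u, mem_nbrFin.2 hu⟩
  have hcyc : cyc2 G = 0 := by
    obtain ⟨m, hm, hm0⟩ := hc.exists_cyc2_eq
    rw [hm, hm0.2 h]; simp
  have hsum := sum_card_nbrFin (G := G)
  rw [hcyc] at hsum
  -- The degrees sum to 2|V| - 2, so they cannot all be at least 2.
  obtain ⟨l, hl⟩ : ∃ l, #(nbrFin G l) = 1 := by
    by_contra hcon
    push Not at hcon
    have : ∑ v : V, (2 : ℤ) ≤ ∑ v, (#(nbrFin G v) : ℤ) :=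
      sum_le_sum fun v _ => by have := hpos v; have := hcon v; omega
    simp only [sum_const, card_univ, nsmul_eq_mul] at this
    linarith
  have leaf : ∀ l, #(nbrFin G l) = 1 → ∀ x y, G.Adj l x → G.Adj l y → x = y :=
    fun l hl x y hx hy => card_le_one.1 hl.le x (mem_nbrFin.2 hx) y (mem_nbrFin.2 hy)
  obtain ⟨z, hz⟩ := hc.preconnected.exists_adj_of_nontrivial l
  have hzl : #(nbrFin G z) ≠ 1 := by
    intro hz1
    have hall := hc.forall_mem_of_closed (S := {l, z}) (x := l) (by simp) (by
      rintro u (rfl | rfl) w hw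
      · exact Or.inr (leaf _ hl _ _ hw hz)
      · exact Or.inl (leaf _ hz1 _ _ hw hz.symm))
    have : #(univ : Finset V) ≤ #{l, z} := card_le_card fun w _ => by simpa using hall w
    have h2 := card_le_two (a := l) (b := z)
    rw [card_univ] at this
    omega
  have hLz : ∀ x, #(nbrFin G x) = 1 → G.Adj x z := by
    intro x hx
    by_cases hxl : x = l
    · exact hxl ▸ hz
    · rcases hL l x hl hx (Ne.symm hxl) with hadj | ⟨w, h1, h2⟩
      · exact absurd (leaf l hl x z hadj hz ▸ hx) hzl
      · rw [leaf l hl w z h1 hz] at h2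
        exact h2.symm
  set L : Finset V := {x | #(nbrFin G x) = 1} with hLdef
  have hsub : L ⊆ nbrFin G z := fun x hx => mem_nbrFin.2 (hLz x (by simpa [hLdef] using hx)).symm
  -- Summing this lower bound against 2|V| - 2 shows deg z ≤ #L. As all leaves are neighbours of
  -- `z`, all neighbours of `z` are leaves.
  have hge : ∀ x, (2 : ℤ) - (if x ∈ L then 1 else 0) + (if x = z then (#(nbrFin G z) : ℤ) - 2 else 0)
      ≤ #(nbrFin G x) := by
    intro x
    have h1 := hpos x
    by_cases hxz : x = z
    · subst hxz
      have : x ∉ L := by simpa [hLdef] using hzl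
      simp [this]
    · by_cases hxL : x ∈ L
      · simp only [hxL, hxz, if_true, if_false]; omega
      · have : #(nbrFin G x) ≠ 1 := by simpa [hLdef] using hxL
        simp only [hxL, hxz, if_false]; omega
  have h3 := sum_le_sum fun x (_ : x ∈ univ) => hge x
  rw [hsum, sum_add_distrib, sum_sub_distrib] at h3
  simp only [sum_const, card_univ, nsmul_eq_mul, sum_ite_eq', mem_univ, if_true] at h3
  have h4 : ∑ x : V, (if x ∈ L then (1 : ℤ) else 0) = #L := by simp
  rw [h4] at h3
  have heq : L = nbrFin G z := eq_of_subset_of_card_le hsub (by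
    have : (#(nbrFin G z) : ℤ) ≤ #L := by linarith
    exact_mod_cast this)
  have hall := hc.forall_mem_of_closed (S := {x | x = z ∨ x ∈ L}) (x := z) (Or.inl rfl) (by
    rintro u (rfl | hu) w hw
    · exact Or.inr (heq ▸ mem_nbrFin.2 hw)
    · have hu1 : #(nbrFin G u) = 1 := by simpa [hLdef] using hu
      exact Or.inl (leaf u hu1 _ _ hw (hLz u hu1)))
  refine ⟨z, fun x hx => ?_⟩
  have hx1 : #(nbrFin G x) = 1 := by simpa [hLdef] using (hall x).resolve_left hx
  exact ⟨hx1, hLz x hx1⟩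

/-- After the deletion of `a` the vertex `w` is still not isolated. Applied twice, this gives
minimum degree two. -/
theorem exists_adj_ne (h2 : ∀ v : V, (G.induce {w | w ≠ v}).Connected)
    (hV : 3 ≤ Fintype.card V) {w a : V} (hwa : w ≠ a) : ∃ b, G.Adj w b ∧ b ≠ a := by
  classical
  have : Nontrivial {x | x ≠ a} := by
    have := card_eq_card_ne (v := a)
    exact Fintype.one_lt_card_iff_nontrivial.1 (by omega)
  obtain ⟨b, hb⟩ := (h2 a).preconnected.exists_adj_of_nontrivial ⟨w, hwa⟩
  exact ⟨b, hb, b.2⟩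

theorem two_le_card_of_adj {v a b : V} (ha : G.Adj v a) (hb : G.Adj v b) (hab : a ≠ b) :
    2 ≤ #(nbrFin G v) := by
  classical
  rw [← card_pair hab]
  exact card_le_card (by simp [insert_subset_iff, mem_nbrFin, ha, hb])

theorem exists_isBook_of_three_le (h2 : ∀ v : V, (G.induce {w | w ≠ v}).Connected)
    (hV : 5 ≤ Fintype.card V) (h0 : gammaForm G = 0) {v : V} (hv : 3 ≤ #(nbrFin G v)) :
    ∃ z, IsBook G v z := by
  classical
  set H := G.induce {w | w ≠ v} with hH
  set N := nbrs G v with hN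
  have hcard : Fintype.card V = Fintype.card {w | w ≠ v} + 1 := by
    exact_mod_cast card_eq_card_ne (v := v)
  have hc : H.Connected := h2 v
  have hN3 : 3 ≤ #N := by rwa [hN, card_nbrs]
  obtain ⟨htight, hfar⟩ := eq_of_gammaForm_eq_zero (h2 v) (by omega : 2 ≤ #N)
    (h2 v).gammaForm_nonneg h0
  rw [← hH, ← hN] at htight hfar
  -- A vertex not adjacent to `v` loses no neighbour when `v` is deleted.
  have hdeg : ∀ w, w ∉ N → 2 ≤ #(nbrFin H w) := by
    intro w hw
    have hvw : ¬ G.Adj v w := fun h => hw (mem_nbrs.2 h)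
    obtain ⟨a, ha, hav⟩ := exists_adj_ne h2 (by omega) w.2
    obtain ⟨b, hb, hba⟩ := exists_adj_ne h2 (by omega) ha.ne
    have hbv : b ≠ v := by rintro rfl; exact hvw hb.symm
    have ha' : H.Adj w ⟨a, hav⟩ := ha
    have hb' : H.Adj w ⟨b, hbv⟩ := hb
    exact two_le_card_of_adj ha' hb' fun e => hba (congrArg Subtype.val e).symm
  -- Otherwise all degrees of `H` are at least 2 and sum to 2|V(H)|, so all equal 2. Then the
  -- triangle on `N` is a whole component, `H` has three vertices and `G` only four.
  have htree : H.IsTree := by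
    by_contra hT
    obtain ⟨hcyc, hN', hclique⟩ := hc.triangle_of_totalExcess_eq hN3 htight hT
    have hsub : ∀ w ∈ N, N.erase w ⊆ nbrFin H w := fun w hw x hx => by
      rw [mem_erase] at hx
      exact mem_nbrFin.2 (hclique w hw x hx.2 hx.1.symm)
    have hdeg2 : ∀ w, 2 ≤ #(nbrFin H w) := by
      intro w
      by_cases hw : w ∈ N
      · have := card_le_card (hsub w hw)
        rw [card_erase_of_mem hw] at this
        omega
      · exact hdeg w hw
    have hsum := sum_card_nbrFin (G := H)
    rw [hcyc] at hsum
    have heq : ∀ w, #(nbrFin H w) = 2 := by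
      intro w
      have hle : ∀ x ∈ univ, (2 : ℤ) ≤ #(nbrFin H x) := fun x _ => by exact_mod_cast hdeg2 x
      have := (sum_eq_sum_iff_of_le hle).1 (by
        rw [hsum]; simp only [sum_const, card_univ, nsmul_eq_mul]; ring) w (mem_univ w)
      exact_mod_cast this.symm
    obtain ⟨x, hx⟩ : N.Nonempty := card_pos.1 (by omega)
    have hall := hc.forall_mem_of_closed (S := {x | x ∈ N}) hx (fun u hu w hw => by
      have : N.erase u = nbrFin H u := eq_of_subset_of_card_le (hsub u hu) (by
        rw [heq, card_erase_of_mem hu]; omega)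
      exact mem_of_mem_erase (this ▸ mem_nbrFin.2 hw : w ∈ N.erase u))
    have : #(univ : Finset {w | w ≠ v}) ≤ #N := card_le_card fun w _ => hall w
    rw [card_univ] at this
    omega
  have hleaf : ∀ w, #(nbrFin H w) = 1 → w ∈ N := fun w hw => by
    by_contra hn
    have := hdeg w hn
    omega
  obtain ⟨z, hz⟩ := htree.exists_star (by omega) fun x y hx hy hxy =>
    farPairs_eq_zero hfar (hleaf x hx) (hleaf y hy) hxy
  refine ⟨z, Ne.symm z.2, fun x hxv hxz => ?_⟩
  have hx := hz ⟨x, hxv⟩ fun e => hxz (congrArg Subtype.val e)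
  refine ⟨⟨mem_nbrs.1 (hleaf _ hx.1), (show G.Adj x z from hx.2).symm⟩, fun y hyv hyz hadj => ?_⟩
  have hadj' : H.Adj ⟨x, hxv⟩ ⟨y, hyv⟩ := hadj
  have := card_le_one.1 hx.1.le _ (mem_nbrFin.2 hadj') _ (mem_nbrFin.2 hx.2)
  exact hyz (congrArg Subtype.val this)

/-- If all degrees are at most two, the two neighbours of a vertex `v` are adjacent or have a common
neighbour other than `v`. The resulting 3- or 4-cycle is closed under adjacency, hence is all of
`G`. -/
theorem exists_three_le (hc : G.Connected) (h2 : ∀ v : V, (G.induce {w | w ≠ v}).Connected)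
    (hV : 5 ≤ Fintype.card V) (h0 : gammaForm G = 0) : ∃ v, 3 ≤ #(nbrFin G v) := by
  classical
  by_contra hcon
  push Not at hcon
  have deg2 : ∀ w a b, a ≠ b → G.Adj w a → G.Adj w b → ∀ c, G.Adj w c → c = a ∨ c = b := by
    intro w a b hab ha hb c hadj
    by_contra hne
    push Not at hne
    have : #{c, a, b} ≤ #(nbrFin G w) :=
      card_le_card (by simp [insert_subset_iff, mem_nbrFin, ha, hb, hadj])
    rw [card_insert_of_notMem (by simp [hne]), card_pair hab] at this
    have := hcon w
    omega
  obtain ⟨v⟩ := hc.nonempty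
  have : Nontrivial V := Fintype.one_lt_card_iff_nontrivial.1 (by omega)
  obtain ⟨a, ha⟩ := hc.preconnected.exists_adj_of_nontrivial v
  obtain ⟨b, hb, hba⟩ := exists_adj_ne h2 (by omega) ha.ne
  have hN : 2 ≤ #(nbrs G v) := by
    rw [card_nbrs]
    exact two_le_card_of_adj ha hb hba.symm
  obtain ⟨-, hfar⟩ := eq_of_gammaForm_eq_zero (h2 v) hN (h2 v).gammaForm_nonneg h0
  have hab := farPairs_eq_zero hfar (i := ⟨a, ha.ne'⟩) (j := ⟨b, hb.ne'⟩) (mem_nbrs.2 ha)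
    (mem_nbrs.2 hb) fun e => hba (congrArg Subtype.val e).symm
  have big : ∀ S : Finset V, #S ≤ 4 → v ∈ S → (∀ u ∈ S, ∀ w, G.Adj u w → w ∈ S) → False := by
    intro S hS hv hcl
    have hall := hc.forall_mem_of_closed (S := (S : Set V)) hv hcl
    have : #(univ : Finset V) ≤ #S := card_le_card fun w _ => hall w
    rw [card_univ] at this
    omega
  rcases hab with hab | ⟨x, hax, hxb⟩
  · have hab : G.Adj a b := hab
    refine big {v, a, b} (card_le_three.trans (by omega)) (by simp) ?_
    intro u hu w hw
    simp only [mem_insert, mem_singleton] at hu ⊢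
    rcases hu with rfl | rfl | rfl
    · exact Or.inr (deg2 _ _ _ hba.symm ha hb w hw)
    · rcases deg2 _ _ _ hb.ne ha.symm hab w hw with e | e <;> simp [e]
    · rcases deg2 _ _ _ ha.ne hb.symm hab.symm w hw with e | e <;> simp [e]
  · have hax : G.Adj a x := hax
    have hxb : G.Adj x b := hxb
    have hxv : (x : V) ≠ v := x.2
    refine big {v, a, b, (x : V)} card_le_four (by simp) ?_
    intro u hu w hw
    simp only [mem_insert, mem_singleton] at hu ⊢
    rcases hu with rfl | rfl | rfl | rfl
    · rcases deg2 _ _ _ hba.symm ha hb w hw with e | e <;> simp [e]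
    · rcases deg2 _ _ _ hxv.symm ha.symm hax w hw with e | e <;> simp [e]
    · rcases deg2 _ _ _ hxv.symm hb.symm hxb.symm w hw with e | e <;> simp [e]
    · rcases deg2 _ _ _ hba.symm hax.symm hxb w hw with e | e <;> simp [e]

end Structure

/-! ### Evaluation of the form on books -/

section Book

variable {V : Type} {G : SimpleGraph V} {v z : V}

theorem IsBook.symm (h : IsBook G v z) : IsBook G z v :=
  ⟨h.1.symm, fun x hx1 hx2 => ⟨(h.2 x hx2 hx1).1.symm, fun y h1 h2 => (h.2 x hx2 hx1).2 y h2 h1⟩⟩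

variable [Fintype V]

open Classical in
theorem sum_eq_of_eq_off_pair {f : V → ℤ} {c A B : ℤ}
    (h : ∀ j, f j = c + (if j = v then A else 0) + (if j = z then B else 0)) :
    ∑ j, f j = Fintype.card V * c + A + B := by
  rw [sum_congr rfl fun j _ => h j, sum_add_distrib, sum_add_distrib]
  simp

theorem IsBook.sum_adjInd_mul (h : IsBook G v z) (f : V → ℤ) {x : V} (hv : x ≠ v) (hz : x ≠ z) :
    ∑ y, adjInd G x y * f y = f v + f z := by
  classical
  have h1 := (h.2 x hv hz).1
  rw [sum_eq_of_eq_off_pair (v := v) (z := z) (c := 0) (A := f v) (B := f z)]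
  · ring
  · intro y
    by_cases e1 : y = v
    · subst e1; simp [h.1, adjInd_of_adj G h1.1.symm]
    · by_cases e2 : y = z
      · subst e2; simp [h.1.symm, adjInd_of_adj G h1.2.symm]
      · simp [e1, e2, adjInd_of_not_adj G ((h.2 x hv hz).2 y e1 e2)]

theorem IsBook.codeg_page (h : IsBook G v z) {x y : V} (hv : x ≠ v) (hz : x ≠ z)
    (hv' : y ≠ v) (hz' : y ≠ z) : codeg G x y = 2 := by
  rw [codeg, h.sum_adjInd_mul _ hv hz, adjInd_of_adj G (h.2 y hv' hz').1.1,
    adjInd_of_adj G (h.2 y hv' hz').1.2]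
  rfl

theorem IsBook.codeg_spine_page (h : IsBook G v z) {x : V} (hv : x ≠ v) (hz : x ≠ z) :
    codeg G v x = adjInd G v z := by
  rw [codeg_comm, codeg, h.sum_adjInd_mul _ hv hz, adjInd_self, zero_add, adjInd_comm]

theorem IsBook.sum_adjInd_spine (h : IsBook G v z) :
    ∑ x, adjInd G v x = Fintype.card V - 2 + adjInd G v z := by
  classical
  rw [sum_eq_of_eq_off_pair (v := v) (z := z) (c := 1) (A := -1) (B := adjInd G v z - 1)]
  · ring
  · intro x
    by_cases e1 : x = v
    · subst e1; simp [h.1]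
    · by_cases e2 : x = z
      · subst e2; simp [h.1.symm]
      · simp [e1, e2, adjInd_of_adj G (h.2 x e1 e2).1.1]

theorem IsBook.codeg_spine (h : IsBook G v z) : codeg G v z = Fintype.card V - 2 := by
  classical
  rw [codeg, sum_eq_of_eq_off_pair (v := v) (z := z) (c := 1) (A := -1) (B := -1)]
  · ring
  · intro x
    by_cases e1 : x = v
    · subst e1; simp [h.1]
    · by_cases e2 : x = z
      · subst e2; simp [h.1.symm]
      · simp [e1, e2, adjInd_of_adj G (h.2 x e1 e2).1.1, adjInd_of_adj G (h.2 x e1 e2).1.2.symm]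

theorem IsBook.cyc2_eq (h : IsBook G v z) :
    cyc2 G = 2 * Fintype.card V - 6 + 2 * adjInd G v z := by
  classical
  rw [cyc2, arcs, sum_eq_of_eq_off_pair (v := v) (z := z) (c := 2)
    (A := Fintype.card V - 4 + adjInd G v z) (B := Fintype.card V - 4 + adjInd G v z)]
  · ring
  · intro x
    by_cases e1 : x = v
    · subst e1
      simp only [h.1, if_true, if_false, h.sum_adjInd_spine]; ring
    · by_cases e2 : x = z
      · subst e2
        simp only [h.1.symm, if_true, if_false, h.symm.sum_adjInd_spine, adjInd_comm G x v]; ring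
      · have := h.sum_adjInd_mul (fun _ => 1) e1 e2
        simp only [mul_one] at this
        simp [e1, e2, this]

theorem IsBook.pairWeight_page (h : IsBook G v z) {x y : V} (hv : x ≠ v) (hz : x ≠ z)
    (hv' : y ≠ v) (hz' : y ≠ z) : pairWeight G x y = 6 := by
  simp [pairWeight, farInd, h.codeg_page hv hz hv' hz',
    adjInd_of_not_adj G ((h.2 x hv hz).2 y hv' hz')]

theorem IsBook.pairWeight_spine_page (h : IsBook G v z) {x : V} (hv : x ≠ v) (hz : x ≠ z) :
    pairWeight G v x = 4 * adjInd G v z := by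
  have h1 := (h.2 x hv hz).1.1
  simp only [pairWeight, farInd, h.codeg_spine_page hv hz, h1, adjInd_of_adj G h1, sq,
    adjInd_mul_self]
  simp; ring

theorem IsBook.pairWeight_spine (h : IsBook G v z) (hV : 3 ≤ Fintype.card V) :
    pairWeight G v z = ((Fintype.card V : ℤ) - 2) ^ 2 + 3 * (Fintype.card V - 2) -
      4 * (1 - adjInd G v z) := by
  have : (Fintype.card V : ℤ) - 2 ≠ 0 := by omega
  simp [pairWeight, farInd, h.codeg_spine, this]

open Classical in
theorem IsBook.sum_pairWeight_spine (h : IsBook G v z) :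
    (∑ y, if v = y then 0 else pairWeight G v y) =
      pairWeight G v z + (Fintype.card V - 2) * (4 * adjInd G v z) := by
  rw [sum_eq_of_eq_off_pair (v := v) (z := z) (c := 4 * adjInd G v z) (A := -(4 * adjInd G v z))
    (B := pairWeight G v z - 4 * adjInd G v z)]
  · ring
  · intro y
    by_cases e1 : y = v
    · subst e1; simp [h.1]
    · by_cases e2 : y = z
      · subst e2; simp [h.1, h.1.symm]
      · simp [e1, e2, Ne.symm e1, h.pairWeight_spine_page e1 e2]

open Classical in
theorem IsBook.sum_pairWeight_page (h : IsBook G v z) {x : V} (hv : x ≠ v) (hz : x ≠ z) :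
    (∑ y, if x = y then 0 else pairWeight G x y) =
      6 * (Fintype.card V - 3) + 8 * adjInd G v z := by
  have hadd : (∑ y, if x = y then 0 else pairWeight G x y) + 6 =
      ∑ y, ((if x = y then 0 else pairWeight G x y) + if x = y then 6 else 0) := by
    rw [sum_add_distrib]; simp
  rw [← add_left_inj 6, hadd, sum_eq_of_eq_off_pair (v := v) (z := z) (c := 6)
    (A := 4 * adjInd G v z - 6) (B := 4 * adjInd G v z - 6)]
  · ring
  · intro y
    by_cases e1 : y = v
    · subst e1
      rw [pairWeight_comm, h.pairWeight_spine_page hv hz]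
      simp [h.1, hv]
    · by_cases e2 : y = z
      · subst e2
        rw [pairWeight_comm, h.symm.pairWeight_spine_page hz hv, adjInd_comm]
        simp [h.1.symm, hz]
      · rw [h.pairWeight_page hv hz e1 e2]
        simp only [e1, e2, if_false]
        split_ifs <;> simp

/-- Everything is a polynomial in |V| and ε = `adjInd G v z`, and the form reduces to a multiple of
ε² - ε. Hence the edge `vz` may be present or absent. -/
theorem IsBook.gammaForm_eq_zero (h : IsBook G v z) (hV : 3 ≤ Fintype.card V) :
    gammaForm G = 0 := by
  classical
  have ht : totalWeight G = 2 * (pairWeight G v z + (Fintype.card V - 2) * (4 * adjInd G v z)) +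
      (Fintype.card V - 2) * (6 * (Fintype.card V - 3) + 8 * adjInd G v z) := by
    rw [totalWeight, sum_eq_of_eq_off_pair (v := v) (z := z)
      (c := 6 * (Fintype.card V - 3) + 8 * adjInd G v z)
      (A := pairWeight G v z + (Fintype.card V - 2) * (4 * adjInd G v z) -
        (6 * (Fintype.card V - 3) + 8 * adjInd G v z))
      (B := pairWeight G v z + (Fintype.card V - 2) * (4 * adjInd G v z) -
        (6 * (Fintype.card V - 3) + 8 * adjInd G v z))]
    · ring
    · intro x
      by_cases e1 : x = v
      · subst e1
        rw [h.sum_pairWeight_spine]; simp [h.1]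
      · by_cases e2 : x = z
        · subst e2
          rw [h.symm.sum_pairWeight_spine, pairWeight_comm, adjInd_comm]; simp [h.1.symm]
        · rw [h.sum_pairWeight_page e1 e2]; simp [e1, e2]
  rw [gammaForm, ht, h.cyc2_eq, h.pairWeight_spine hV]
  have hsq := adjInd_mul_self G v z
  linear_combination 8 * hsq

end Book

/-! ### Books are the graphs `G_n` and `K_{2,n-2}` -/

section Iso

variable {n : ℕ} {G : SimpleGraph (Fin n)}

theorem graphGn_adj {p q : Fin 2 ⊕ Fin (n - 2)} : (graphGn n).Adj p q ↔
    (p.isLeft ∧ q.isRight ∨ p.isRight ∧ q.isLeft) ∨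
      (p = Sum.inl 0 ∧ q = Sum.inl 1 ∨ p = Sum.inl 1 ∧ q = Sum.inl 0) := by
  rw [graphGn, SimpleGraph.sup_adj, SimpleGraph.edge_adj, completeBipartiteGraph_adj]
  refine or_congr Iff.rfl (and_iff_left_of_imp ?_)
  rintro (⟨rfl, rfl⟩ | ⟨rfl, rfl⟩) <;> simp

theorem exists_equiv_apply_eq {v z : Fin n} (hvz : v ≠ z) :
    ∃ e : Fin n ≃ Fin 2 ⊕ Fin (n - 2), e v = Sum.inl 0 ∧ e z = Sum.inl 1 := by
  have hn : 2 ≤ n := by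
    have := v.2; have := z.2; have := Fin.val_ne_of_ne hvz; omega
  let e0 : Fin n ≃ Fin 2 ⊕ Fin (n - 2) := Fintype.equivOfCardEq (by simp; omega)
  let e1 := e0.trans (Equiv.swap (e0 v) (Sum.inl 0))
  have h1 : e1 v = Sum.inl 0 := by simp [e1]
  refine ⟨e1.trans (Equiv.swap (e1 z) (Sum.inl 1)), ?_, by simp⟩
  rw [Equiv.trans_apply, h1, Equiv.swap_apply_of_ne_of_ne]
  · rw [← h1]; exact e1.injective.ne hvz
  · simp

theorem IsBook.nonempty_iso {v z : Fin n} (h : IsBook G v z) :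
    Nonempty (G ≃g graphGn n) ∨ Nonempty (G ≃g completeBipartiteGraph (Fin 2) (Fin (n - 2))) := by
  obtain ⟨e, hv, hz⟩ := exists_equiv_apply_eq h.1
  have hother : ∀ x, x ≠ v → x ≠ z → ∃ j, e x = Sum.inr j := by
    intro x hxv hxz
    have h1 : e x ≠ Sum.inl 0 := hv ▸ e.injective.ne hxv
    have h2 : e x ≠ Sum.inl 1 := hz ▸ e.injective.ne hxz
    rcases hx : e x with i | j
    · rw [hx] at h1 h2
      fin_cases i <;> simp_all
    · exact ⟨j, rfl⟩
  -- One formula serves both target graphs: the extra edge is guarded by the adjacency of `v` and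
  -- `z`.
  have key : ∀ x y : Fin n, ((e x).isLeft ∧ (e y).isRight ∨ (e x).isRight ∧ (e y).isLeft) ∨
      (e x = Sum.inl 0 ∧ e y = Sum.inl 1 ∨ e x = Sum.inl 1 ∧ e y = Sum.inl 0) ∧ G.Adj v z ↔
      G.Adj x y := by
    intro x y
    by_cases hxv : x = v
    · subst hxv
      by_cases hyv : y = x
      · subst hyv; simp [hv]
      · by_cases hyz : y = z
        · subst hyz; simp [hv, hz]
        · obtain ⟨j, hj⟩ := hother y hyv hyz
          simp [hv, hj, (h.2 y hyv hyz).1.1]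
    · by_cases hxz : x = z
      · subst hxz
        by_cases hyv : y = v
        · subst hyv; simp [hv, hz, G.adj_comm]
        · by_cases hyz : y = x
          · subst hyz; simp [hz]
          · obtain ⟨j, hj⟩ := hother y hyv hyz
            simp [hz, hj, (h.2 y hyv hyz).1.2]
      · obtain ⟨i, hi⟩ := hother x hxv hxz
        have hx := h.2 x hxv hxz
        by_cases hyv : y = v
        · subst hyv; simp [hv, hi, hx.1.1.symm]
        · by_cases hyz : y = z
          · subst hyz; simp [hz, hi, hx.1.2.symm]
          · obtain ⟨j, hj⟩ := hother y hyv hyz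
            simp [hj, hi, hx.2 y hyv hyz]
  by_cases hadj : G.Adj v z
  · refine Or.inl ⟨e, ?_⟩
    intro x y
    rw [← key x y, graphGn_adj, and_iff_left hadj]
  · refine Or.inr ⟨e, ?_⟩
    intro x y
    rw [← key x y, completeBipartiteGraph_adj]
    simp [hadj]

theorem exists_isBook_of_iso {K : SimpleGraph (Fin 2 ⊕ Fin (n - 2))} (e : G ≃g K)
    (h : IsBook K (Sum.inl 0) (Sum.inl 1)) : ∃ v z, IsBook G v z := by
  refine ⟨e.symm (Sum.inl 0), e.symm (Sum.inl 1), e.symm.injective.ne h.1, fun x hv hz => ?_⟩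
  have hne : ∀ (x : Fin n) p, x ≠ e.symm p → e x ≠ p := by
    rintro x p hx rfl
    exact hx (e.symm_apply_apply x).symm
  have h1 := h.2 (e x) (hne x _ hv) (hne x _ hz)
  refine ⟨⟨?_, ?_⟩, fun y hv' hz' => ?_⟩
  · rw [← e.map_adj_iff, e.apply_symm_apply]; exact h1.1.1
  · rw [← e.map_adj_iff, e.apply_symm_apply]; exact h1.1.2
  · rw [← e.map_adj_iff]; exact h1.2 _ (hne y _ hv') (hne y _ hz')

theorem isBook_completeBipartiteGraph :
    IsBook (completeBipartiteGraph (Fin 2) (Fin (n - 2))) (Sum.inl 0) (Sum.inl 1) := by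
  refine ⟨by simp, ?_⟩
  rintro (i | i) h0 h1
  · fin_cases i <;> simp_all
  · refine ⟨by simp, ?_⟩
    rintro (j | j) h0' h1'
    · fin_cases j <;> simp_all
    · simp

theorem isBook_graphGn : IsBook (graphGn n) (Sum.inl 0) (Sum.inl 1) := by
  refine ⟨by simp, ?_⟩
  rintro (i | i) h0 h1
  · fin_cases i <;> simp_all
  · refine ⟨by simp [graphGn_adj], ?_⟩
    rintro (j | j) h0' h1'
    · fin_cases j <;> simp_all
    · simp [graphGn_adj]

/-- For 2-connected graphs on at least five vertices, the form vanishes exactly on `G_n` and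
`K_{2,n-2}`. -/
theorem gammaForm_eq_zero_iff (hG : IsTwoConnected G) (hn : 5 ≤ n) : gammaForm G = 0 ↔
    Nonempty (G ≃g graphGn n) ∨
      Nonempty (G ≃g completeBipartiteGraph (Fin 2) (Fin (n - 2))) := by
  constructor
  · intro h0
    obtain ⟨v, hv⟩ := exists_three_le hG.2.1 hG.2.2 (by simpa using hn) h0
    obtain ⟨z, hz⟩ := exists_isBook_of_three_le hG.2.2 (by simpa using hn) h0 hv
    exact hz.nonempty_iso
  · rintro (⟨⟨e⟩⟩ | ⟨⟨e⟩⟩)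
    · obtain ⟨v, z, h⟩ := exists_isBook_of_iso e isBook_graphGn
      exact h.gammaForm_eq_zero (by simp; omega)
    · obtain ⟨v, z, h⟩ := exists_isBook_of_iso e isBook_completeBipartiteGraph
      exact h.gammaForm_eq_zero (by simp; omega)

end Iso

/-! ### Lattice points of the dilated symmetric edge polytope -/

section LatticePoints

theorem exists_single_le {V : Type} [Fintype V] [DecidableEq V] {g : V → ℤ} (h0 : ∀ x, 0 ≤ g x)
    {m : ℤ} (hm : 0 ≤ m) (hs : ∑ x, g x = m + 1) :
    ∃ (i : V) (g' : V → ℤ), g = Pi.single i 1 + g' ∧ (∀ x, 0 ≤ g' x) ∧ ∑ x, g' x = m := by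
  obtain ⟨i, -, hi⟩ : ∃ i ∈ univ, 0 < g i := exists_lt_of_sum_lt (by simp; omega)
  refine ⟨i, g - Pi.single i 1, by simp, fun x => ?_, ?_⟩
  · have := h0 x
    by_cases hx : x = i
    · subst hx; simp; omega
    · simp [hx, this]
  · simp [hs]

variable {n : ℕ} {G : SimpleGraph (Fin n)}

/-- The coordinates of a lattice point, as real numbers. -/
def toReal (z : Fin n → ℤ) : Fin n → ℝ := fun i => (z i : ℝ)

/-- The difference of two unit vectors. -/
def unitDiff (i j : Fin n) : Fin n → ℤ := Pi.single i 1 - Pi.single j 1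

/-- The sum of two unit vectors. -/
def unitSum (i j : Fin n) : Fin n → ℤ := Pi.single i 1 + Pi.single j 1

theorem toReal_unitDiff (i j : Fin n) :
    toReal (unitDiff i j) = Pi.single i 1 - Pi.single j 1 := by
  ext x
  simp only [toReal, unitDiff, Pi.sub_apply, Pi.single_apply]
  push_cast
  rfl

theorem toReal_add (y z : Fin n → ℤ) : toReal (y + z) = toReal y + toReal z := by
  ext x; simp [toReal]

theorem unitSum_sub_unitSum (i j k l : Fin n) :
    unitSum i j - unitSum k l = unitDiff i k + unitDiff j l := by
  unfold unitSum unitDiff; abel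

theorem sum_mul_unitDiff (f : Fin n → ℤ) (i j : Fin n) :
    ∑ x, f x * unitDiff i j x = f i - f j := by
  simp [unitDiff, mul_sub, Pi.single_apply]

theorem toReal_unitDiff_mem {i j : Fin n} (h : G.Adj i j) :
    toReal (unitDiff i j) ∈ symmetricEdgePolytope G :=
  subset_convexHull ℝ _ ⟨i, j, h, toReal_unitDiff i j⟩

theorem zero_mem_symmetricEdgePolytope {i j : Fin n} (h : G.Adj i j) :
    (0 : Fin n → ℝ) ∈ symmetricEdgePolytope G := by
  have h1 := toReal_unitDiff_mem h
  have h2 := toReal_unitDiff_mem h.symm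
  have := (convex_convexHull ℝ _).midpoint_mem h1 h2
  rwa [toReal_unitDiff, toReal_unitDiff,
    ← neg_sub (Pi.single i 1 : Fin n → ℝ) (Pi.single j 1), midpoint_self_neg] at this

open scoped Pointwise in
theorem add_mem_two_smul {x y : Fin n → ℝ} (hx : x ∈ symmetricEdgePolytope G)
    (hy : y ∈ symmetricEdgePolytope G) : x + y ∈ ((2 : ℕ) : ℝ) • symmetricEdgePolytope G := by
  have := (convex_convexHull ℝ _).midpoint_mem hx hy
  refine ⟨_, this, ?_⟩
  simp [midpoint_eq_smul_add]

open scoped Pointwise in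
/-- A function on the vertices that changes by at most one along each edge is bounded by `k` on
the `k`-th dilation of the symmetric edge polytope. -/
theorem sum_mul_le_of_mem {f : Fin n → ℤ} (hf : ∀ x y, G.Adj x y → f x - f y ≤ 1) {k : ℕ}
    {z : Fin n → ℤ} (hz : toReal z ∈ (k : ℝ) • symmetricEdgePolytope G) :
    ∑ x, f x * z x ≤ k := by
  have hsub : symmetricEdgePolytope G ⊆ {x | ∑ i, (f i : ℝ) * x i ≤ 1} := by
    refine convexHull_min ?_ ?_
    · rintro _ ⟨i, j, hij, rfl⟩
      simp only [Set.mem_ofPred_eq, Pi.sub_apply, mul_sub, sum_sub_distrib, Pi.single_apply,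
        mul_ite, mul_one, mul_zero, sum_ite_eq', mem_univ, if_true]
      exact_mod_cast hf i j hij
    · refine convex_halfSpace_le (f := fun x : Fin n → ℝ => ∑ i, (f i : ℝ) * x i) ?_ 1
      constructor
      · intro x y; simp [mul_add, sum_add_distrib]
      · intro c x; simp only [Pi.smul_apply, smul_eq_mul, mul_sum]
        exact sum_congr rfl fun i _ => by ring
  obtain ⟨y, hy, hyz⟩ := hz
  have h1 : ∑ i, (f i : ℝ) * y i ≤ 1 := hsub hy
  have h2 : ∑ i, (f i : ℝ) * toReal z i = k * ∑ i, (f i : ℝ) * y i := by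
    rw [← hyz, mul_sum]
    refine sum_congr rfl fun i _ => ?_
    simp only [Pi.smul_apply, smul_eq_mul]; ring
  have h3 : ∑ i, (f i : ℝ) * toReal z i ≤ k := by
    rw [h2]
    exact (mul_le_mul_of_nonneg_left h1 (Nat.cast_nonneg k)).trans_eq (mul_one _)
  unfold toReal at h3
  exact_mod_cast h3

open Classical in
/-- The distance to a set of vertices, truncated at two. -/
noncomputable def truncDist (G : SimpleGraph (Fin n)) (S : Set (Fin n)) (x : Fin n) : ℤ :=
  if x ∈ S then 0 else if ∃ y ∈ S, G.Adj x y then 1 else 2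

theorem truncDist_of_mem {S : Set (Fin n)} {x : Fin n} (h : x ∈ S) : truncDist G S x = 0 :=
  if_pos h

theorem truncDist_of_not_adj {S : Set (Fin n)} {x : Fin n} (h : x ∉ S)
    (h' : ∀ y ∈ S, ¬ G.Adj x y) : truncDist G S x = 2 := by
  rw [truncDist, if_neg h, if_neg (by push Not; exact h')]

theorem one_le_truncDist {S : Set (Fin n)} {x : Fin n} (h : x ∉ S) : 1 ≤ truncDist G S x := by
  rw [truncDist, if_neg h]; split_ifs <;> simp

theorem truncDist_sub_le {S : Set (Fin n)} {x y : Fin n} (h : G.Adj x y) :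
    truncDist G S x - truncDist G S y ≤ 1 := by
  unfold truncDist
  by_cases hy : y ∈ S
  · have hx : ∃ y ∈ S, G.Adj x y := ⟨y, hy, h⟩
    simp only [hy, hx, if_true]
    split_ifs <;> simp
  · simp only [hy, if_false]
    split_ifs <;> simp

open scoped Pointwise in
/-- The shape of the lattice points in the first two dilations. -/
theorem shape_of_mem {k : ℕ} (hk : k ≤ 2) {z : Fin n → ℤ}
    (hz : toReal z ∈ (k : ℝ) • symmetricEdgePolytope G) :
    z = 0 ∨ (1 ≤ k ∧ ∃ i j, i ≠ j ∧ z = unitDiff i j) ∨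
      (k = 2 ∧ ∃ i j a b, i ≠ a ∧ i ≠ b ∧ j ≠ a ∧ j ≠ b ∧ z = unitSum i j - unitSum a b) := by
  have hsum : ∑ x, z x = 0 := by
    -- Constants satisfy the edge condition vacuously; since 3 > k, the integral coordinate sum must
    -- be 0.
    have h1 := sum_mul_le_of_mem (f := fun _ => 3) (by simp) hz
    have h2 := sum_mul_le_of_mem (f := fun _ => -3) (by simp) hz
    rw [← mul_sum] at h1 h2
    omega
  -- The indicator of the positive support bounds the sum of the positive parts by `k`.
  have hpos := sum_mul_le_of_mem (f := fun x => if 0 < z x then 1 else 0)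
    (by intro x y _; split_ifs <;> simp) hz
  set p : Fin n → ℤ := fun x => max (z x) 0 with hp
  set q : Fin n → ℤ := fun x => max (-z x) 0 with hq
  have hzpq : z = p - q := by ext x; simp only [hp, hq, Pi.sub_apply]; omega
  have hp0 : ∀ x, 0 ≤ p x := fun x => le_max_right _ _
  have hq0 : ∀ x, 0 ≤ q x := fun x => le_max_right _ _
  have hdisj : ∀ x, p x = 0 ∨ q x = 0 := fun x => by simp only [hp, hq]; omega
  have hpk : ∑ x, p x ≤ k := by
    refine le_trans (le_of_eq (sum_congr rfl fun x _ => ?_)) hpos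
    simp only [hp]; split_ifs <;> omega
  have hpq : ∑ x, q x = ∑ x, p x := by
    have : ∑ x, z x = ∑ x, p x - ∑ x, q x := by
      rw [← sum_sub_distrib]; exact sum_congr rfl fun x _ => congrFun hzpq x
    linarith
  have hs0 : 0 ≤ ∑ x, p x := sum_nonneg fun x _ => hp0 x
  clear_value p q
  have zero : ∀ g : Fin n → ℤ, (∀ x, 0 ≤ g x) → ∑ x, g x = 0 → g = 0 := fun g hg h => by
    ext x; exact (sum_eq_zero_iff_of_nonneg fun x _ => hg x).1 h x (mem_univ x)
  obtain h | h | h : ∑ x, p x = 0 ∨ ∑ x, p x = 1 ∨ ∑ x, p x = 2 := by omega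
  · left
    rw [hzpq, zero p hp0 h, zero q hq0 (hpq.trans h), sub_zero]
  · right; left
    refine ⟨by omega, ?_⟩
    obtain ⟨i, p', rfl, hp1, hp2⟩ := exists_single_le hp0 le_rfl h
    obtain ⟨j, q', rfl, hq1, hq2⟩ := exists_single_le hq0 le_rfl (hpq.trans h)
    rw [zero p' hp1 hp2, zero q' hq1 hq2] at hzpq
    refine ⟨i, j, ?_, by simpa [unitDiff] using hzpq⟩
    rintro rfl
    have := hdisj i
    have := hp1 i
    have := hq1 i
    simp only [Pi.add_apply, Pi.single_eq_same] at *
    omega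
  · right; right
    refine ⟨by omega, ?_⟩
    obtain ⟨i, p', rfl, hp1, hp2⟩ := exists_single_le hp0 zero_le_one h
    obtain ⟨j, p'', rfl, hp3, hp4⟩ := exists_single_le hp1 le_rfl hp2
    obtain ⟨a, q', rfl, hq1, hq2⟩ := exists_single_le hq0 zero_le_one (hpq.trans h)
    obtain ⟨b, q'', rfl, hq3, hq4⟩ := exists_single_le hq1 le_rfl hq2
    obtain rfl := zero p'' hp3 hp4
    obtain rfl := zero q'' hq3 hq4
    have hne : ∀ x y, (x = i ∨ x = j) → (y = a ∨ y = b) → x ≠ y := by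
      rintro x y hx hy rfl
      have h1 := hdisj x
      simp only [Pi.add_apply, Pi.single_apply, Pi.zero_apply] at h1
      split_ifs at h1 <;> omega
    exact ⟨i, j, a, b, hne i a (.inl rfl) (.inl rfl), hne i b (.inl rfl) (.inr rfl),
      hne j a (.inr rfl) (.inl rfl), hne j b (.inr rfl) (.inr rfl),
      by simpa [unitSum] using hzpq⟩

open scoped Pointwise in
theorem unitDiff_mem_one_iff {i j : Fin n} (hij : i ≠ j) :
    toReal (unitDiff i j) ∈ ((1 : ℕ) : ℝ) • symmetricEdgePolytope G ↔ G.Adj i j := by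
  constructor
  · intro h
    by_contra hadj
    have := sum_mul_le_of_mem (fun x y h => truncDist_sub_le (S := {j}) h) h
    rw [sum_mul_unitDiff, truncDist_of_mem (Set.mem_singleton j),
      truncDist_of_not_adj (x := i) (by simpa using hij) (by simpa using hadj)] at this
    norm_num at this
  · intro h
    simpa using toReal_unitDiff_mem h

open scoped Pointwise in
theorem unitDiff_mem_two_iff {i j : Fin n} (hij : i ≠ j) :
    toReal (unitDiff i j) ∈ ((2 : ℕ) : ℝ) • symmetricEdgePolytope G ↔
      G.Adj i j ∨ ∃ x, G.Adj i x ∧ G.Adj x j := by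
  classical
  constructor
  · intro h
    by_contra hcon
    push Not at hcon
    obtain ⟨hadj, hx⟩ := hcon
    have h2 : ∀ y, G.Adj i y → truncDist G {j} y = 2 := fun y hy =>
      truncDist_of_not_adj (fun e : y = j => hadj (e ▸ hy)) (fun w hw => by
        rw [Set.mem_singleton_iff] at hw
        exact hw ▸ hx y hy)
    -- All neighbours of `i` have truncated distance 2 from `j`, so the value at `i` can be raised
    -- to 3, which exceeds the allowed 2.
    have := sum_mul_le_of_mem (f := fun x => truncDist G {j} x + if x = i then 1 else 0)
      (fun x y hxy => by
        have h3 := truncDist_sub_le (S := {j}) hxy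
        by_cases hxi : x = i
        · subst hxi
          have h4 : truncDist G {j} x ≤ 2 := by unfold truncDist; split_ifs <;> simp
          rw [if_pos rfl, h2 y hxy, if_neg hxy.ne']
          omega
        · rw [if_neg hxi]
          split_ifs <;> omega) h
    rw [sum_mul_unitDiff, truncDist_of_mem (Set.mem_singleton j),
      truncDist_of_not_adj (x := i) (by simpa using hij) (by simpa using hadj), if_pos rfl,
      if_neg hij.symm] at this
    norm_num at this
  · rintro (h | ⟨x, h1, h2⟩)
    · have := add_mem_two_smul (toReal_unitDiff_mem h) (zero_mem_symmetricEdgePolytope h)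
      rwa [add_zero] at this
    · have := add_mem_two_smul (toReal_unitDiff_mem h1) (toReal_unitDiff_mem h2)
      rw [← toReal_add] at this
      convert this using 2
      unfold unitDiff; abel

open scoped Pointwise in
-- The truncated distances to {a, b} and to {i, j} show that each of the four vertices has a
-- neighbour in the opposite pair. For pairs this is Hall's condition and yields a matching.
theorem unitSum_sub_mem_two_iff {i j a b : Fin n} (hia : i ≠ a) (hib : i ≠ b) (hja : j ≠ a)
    (hjb : j ≠ b) :
    toReal (unitSum i j - unitSum a b) ∈ ((2 : ℕ) : ℝ) • symmetricEdgePolytope G ↔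
      (G.Adj i a ∧ G.Adj j b) ∨ (G.Adj i b ∧ G.Adj j a) := by
  have hmem : ∀ i j a b, G.Adj i a → G.Adj j b →
      toReal (unitSum i j - unitSum a b) ∈ ((2 : ℕ) : ℝ) • symmetricEdgePolytope G := by
    intro i j a b h1 h2
    rw [unitSum_sub_unitSum, toReal_add]
    exact add_mem_two_smul (toReal_unitDiff_mem h1) (toReal_unitDiff_mem h2)
  constructor
  · intro h
    have hval : ∀ f : Fin n → ℤ, (∀ x y, G.Adj x y → f x - f y ≤ 1) →
        f i + f j - f a - f b ≤ 2 := by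
      intro f hf
      have := sum_mul_le_of_mem hf h
      rw [unitSum_sub_unitSum] at this
      simp only [Pi.add_apply, mul_add, sum_add_distrib, sum_mul_unitDiff] at this
      push_cast at this
      linarith
    have h1 := hval (truncDist G {a, b}) fun x y h => truncDist_sub_le h
    rw [truncDist_of_mem (x := a) (by simp), truncDist_of_mem (x := b) (by simp)] at h1
    have h2 := hval (fun x => - truncDist G {i, j} x) fun x y h => by
      have := truncDist_sub_le (S := {i, j}) h.symm
      linarith
    rw [truncDist_of_mem (x := i) (by simp), truncDist_of_mem (x := j) (by simp)] at h2
    have hi := one_le_truncDist (G := G) (S := {a, b}) (x := i) (by simp [hia, hib])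
    have hj := one_le_truncDist (G := G) (S := {a, b}) (x := j) (by simp [hja, hjb])
    have ha := one_le_truncDist (G := G) (S := {i, j}) (x := a) (by simp [hia.symm, hja.symm])
    have hb := one_le_truncDist (G := G) (S := {i, j}) (x := b) (by simp [hib.symm, hjb.symm])
    have ei : G.Adj i a ∨ G.Adj i b := by
      by_contra hcon
      push Not at hcon
      rw [truncDist_of_not_adj (x := i) (by simp [hia, hib]) (by simpa using hcon)] at h1
      omega
    have ej : G.Adj j a ∨ G.Adj j b := by
      by_contra hcon
      push Not at hcon
      rw [truncDist_of_not_adj (x := j) (by simp [hja, hjb]) (by simpa using hcon)] at h1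
      omega
    have ea : G.Adj i a ∨ G.Adj j a := by
      by_contra hcon
      push Not at hcon
      rw [truncDist_of_not_adj (x := a) (by simp [hia.symm, hja.symm])
        (by simpa [G.adj_comm a] using hcon)] at h2
      omega
    have eb : G.Adj i b ∨ G.Adj j b := by
      by_contra hcon
      push Not at hcon
      rw [truncDist_of_not_adj (x := b) (by simp [hib.symm, hjb.symm])
        (by simpa [G.adj_comm b] using hcon)] at h2
      omega
    tauto
  · rintro (⟨h1, h2⟩ | ⟨h1, h2⟩)
    · exact hmem i j a b h1 h2
    · have := hmem i j b a h1 h2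
      rwa [show unitSum b a = unitSum a b from add_comm _ _] at this

end LatticePoints

/-! ### The first two values of the Ehrhart polynomial -/

section Counting

variable {n : ℕ} {G : SimpleGraph (Fin n)}

/-- Uniqueness of the decomposition into positive and negative parts. -/
theorem eq_of_sub_eq_sub {p q p' q' : Fin n → ℤ} (hp : ∀ x, 0 ≤ p x) (hq : ∀ x, 0 ≤ q x)
    (hp' : ∀ x, 0 ≤ p' x) (hq' : ∀ x, 0 ≤ q' x) (h : ∀ x, p x = 0 ∨ q x = 0)
    (h' : ∀ x, p' x = 0 ∨ q' x = 0) (e : p - q = p' - q') : p = p' ∧ q = q' := by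
  constructor <;> ext x <;> have h1 := congrFun e x <;> simp only [Pi.sub_apply] at h1 <;>
    have := hp x <;> have := hq x <;> have := hp' x <;> have := hq' x <;> have := h x <;>
    have := h' x <;> omega

theorem unitSum_nonneg (i j x : Fin n) : 0 ≤ unitSum i j x := by
  simp only [unitSum, Pi.add_apply, Pi.single_apply]
  split_ifs <;> simp

theorem unitSum_eq_zero_or {i j a b : Fin n} (hia : i ≠ a) (hib : i ≠ b) (hja : j ≠ a)
    (hjb : j ≠ b) (x : Fin n) : unitSum i j x = 0 ∨ unitSum a b x = 0 := by
  simp only [unitSum, Pi.add_apply, Pi.single_apply]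
  split_ifs <;> simp_all

theorem unitSum_eq_iff {i j i' j' : Fin n} :
    unitSum i j = unitSum i' j' ↔ (i = i' ∧ j = j') ∨ (i = j' ∧ j = i') := by
  constructor
  · intro h
    have h1 := congrFun h i
    have h2 := congrFun h j
    have h3 := congrFun h i'
    simp only [unitSum, Pi.add_apply, Pi.single_apply] at h1 h2 h3
    split_ifs at h1 h2 h3 <;> omega
  · rintro (⟨rfl, rfl⟩ | ⟨rfl, rfl⟩)
    · rfl
    · exact add_comm _ _

theorem sum_unitSum (i j : Fin n) : ∑ x, unitSum i j x = 2 := by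
  simp [unitSum, sum_add_distrib]

/-- The difference of two sums of unit vectors. -/
def quadPoint (t : (Fin n × Fin n) × (Fin n × Fin n)) : Fin n → ℤ :=
  unitSum t.1.1 t.1.2 - unitSum t.2.1 t.2.2

/-- The two pairs of vertices have no common element, and can be matched by edges of `G`. -/
def IsMatched (G : SimpleGraph (Fin n)) (t : (Fin n × Fin n) × (Fin n × Fin n)) : Prop :=
  (t.1.1 ≠ t.2.1 ∧ t.1.1 ≠ t.2.2 ∧ t.1.2 ≠ t.2.1 ∧ t.1.2 ≠ t.2.2) ∧
    ((G.Adj t.1.1 t.2.1 ∧ G.Adj t.1.2 t.2.2) ∨ (G.Adj t.1.1 t.2.2 ∧ G.Adj t.1.2 t.2.1))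

theorem quadPoint_eq_iff {t s : (Fin n × Fin n) × (Fin n × Fin n)} (ht : IsMatched G t)
    (hs : IsMatched G s) : quadPoint t = quadPoint s ↔
      unitSum t.1.1 t.1.2 = unitSum s.1.1 s.1.2 ∧ unitSum t.2.1 t.2.2 = unitSum s.2.1 s.2.2 := by
  constructor
  · obtain ⟨⟨h1, h2, h3, h4⟩, -⟩ := ht
    obtain ⟨⟨h1', h2', h3', h4'⟩, -⟩ := hs
    exact eq_of_sub_eq_sub (unitSum_nonneg _ _) (unitSum_nonneg _ _) (unitSum_nonneg _ _)
      (unitSum_nonneg _ _) (unitSum_eq_zero_or h1 h2 h3 h4) (unitSum_eq_zero_or h1' h2' h3' h4')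
  · rintro ⟨h1, h2⟩
    rw [quadPoint, h1, h2, quadPoint]

theorem unitDiff_injOn : Set.InjOn (fun p : Fin n × Fin n => unitDiff p.1 p.2)
    {p | p.1 ≠ p.2} := by
  rintro ⟨i, j⟩ hij ⟨i', j'⟩ hij' h
  have h1 := congrFun h i
  have h2 := congrFun h j
  simp only [unitDiff, Pi.sub_apply, Pi.single_apply] at h1 h2
  have hij : i ≠ j := hij
  have hij' : i' ≠ j' := hij'
  by_cases e1 : i = i' <;> by_cases e2 : i = j' <;> by_cases e3 : j = i' <;>
    by_cases e4 : j = j' <;> simp_all [eq_comm]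

theorem unitDiff_ne_zero {i j : Fin n} (h : i ≠ j) : unitDiff i j ≠ 0 := fun e => by
  have := congrFun e i
  simp [unitDiff, h] at this

theorem quadPoint_ne_zero {t : (Fin n × Fin n) × (Fin n × Fin n)} (ht : IsMatched G t) :
    quadPoint t ≠ 0 := fun e => by
  obtain ⟨⟨h1, h2, h3, h4⟩, -⟩ := ht
  have := (eq_of_sub_eq_sub (p' := 0) (q' := 0) (unitSum_nonneg _ _) (unitSum_nonneg _ _)
    (fun _ => le_rfl) (fun _ => le_rfl) (unitSum_eq_zero_or h1 h2 h3 h4) (fun _ => Or.inl rfl)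
    (e.trans (sub_zero 0).symm)).1
  have h := sum_unitSum t.1.1 t.1.2
  rw [this] at h
  simp at h

theorem quadPoint_ne_unitDiff {t : (Fin n × Fin n) × (Fin n × Fin n)} (ht : IsMatched G t)
    {i j : Fin n} (hij : i ≠ j) : quadPoint t ≠ unitDiff i j := fun e => by
  obtain ⟨⟨h1, h2, h3, h4⟩, -⟩ := ht
  have hnn : ∀ i x : Fin n, 0 ≤ (Pi.single i 1 : Fin n → ℤ) x := fun i x => by
    rw [Pi.single_apply]; split_ifs <;> simp
  have := (eq_of_sub_eq_sub (unitSum_nonneg _ _) (unitSum_nonneg _ _) (hnn i) (hnn j)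
    (unitSum_eq_zero_or h1 h2 h3 h4) (fun x => by
      simp only [Pi.single_apply]; split_ifs <;> simp_all) e).1
  have h := sum_unitSum t.1.1 t.1.2
  rw [this] at h
  simp at h

open Classical in
/-- The pairs of adjacent vertices. -/
noncomputable def arcSet (G : SimpleGraph (Fin n)) : Finset (Fin n × Fin n) :=
  {p | G.Adj p.1 p.2}

open Classical in
/-- The pairs of distinct vertices at distance at most two. -/
noncomputable def nearSet (G : SimpleGraph (Fin n)) : Finset (Fin n × Fin n) :=
  {p | p.1 ≠ p.2 ∧ (G.Adj p.1 p.2 ∨ ∃ x, G.Adj p.1 x ∧ G.Adj x p.2)}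

open Classical in
/-- The quadruples of vertices that consist of two disjoint pairs matched by edges. -/
noncomputable def quadSet (G : SimpleGraph (Fin n)) :
    Finset ((Fin n × Fin n) × (Fin n × Fin n)) :=
  {t | IsMatched G t}

theorem zero_toReal_mem {i j : Fin n} (h : G.Adj i j) (k : ℕ) :
    toReal (0 : Fin n → ℤ) ∈ {x | ∃ y ∈ symmetricEdgePolytope G, (k : ℝ) • y = x} :=
  ⟨0, zero_mem_symmetricEdgePolytope h, by ext; simp [toReal]⟩

theorem ehrhart_zero {i j : Fin n} (h : G.Adj i j) : ehrhart (symmetricEdgePolytope G) 0 = 1 := by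
  classical
  rw [ehrhart, Set.ncard_eq_one]
  refine ⟨0, ?_⟩
  ext z
  constructor
  · intro hz
    rcases shape_of_mem (by omega) hz with rfl | ⟨h1, -⟩ | ⟨h1, -⟩
    · rfl
    · omega
    · omega
  · rintro rfl
    exact zero_toReal_mem h 0

theorem card_arcSet : (#(arcSet G) : ℤ) = arcs G := by
  rw [arcSet, card_filter, arcs, Fintype.sum_prod_type]
  push_cast
  rfl

theorem ehrhart_one {i j : Fin n} (h : G.Adj i j) :
    (ehrhart (symmetricEdgePolytope G) 1 : ℤ) = 1 + arcs G := by
  classical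
  have hset : {z : Fin n → ℤ | (fun i => (z i : ℝ)) ∈
      open scoped Pointwise in ((1 : ℕ) : ℝ) • symmetricEdgePolytope G} =
      ((insert 0 ((arcSet G).image fun p => unitDiff p.1 p.2) : Finset (Fin n → ℤ)) :
        Set (Fin n → ℤ)) := by
    ext z
    simp only [coe_insert, coe_image, Set.mem_insert_iff, Set.mem_image, mem_coe]
    constructor
    · intro hz
      rcases shape_of_mem (by omega) hz with rfl | ⟨-, a, b, hab, rfl⟩ | ⟨h1, -⟩
      · exact Or.inl rfl
      · exact Or.inr ⟨(a, b), by simpa [arcSet] using (unitDiff_mem_one_iff hab).1 hz, rfl⟩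
      · omega
    · rintro (rfl | ⟨p, hp, rfl⟩)
      · exact zero_toReal_mem h 1
      · have hp : G.Adj p.1 p.2 := by simpa [arcSet] using hp
        exact (unitDiff_mem_one_iff hp.ne).2 hp
  rw [ehrhart, hset, Set.ncard_coe_finset, card_insert_of_notMem, card_image_of_injOn]
  · push_cast; rw [card_arcSet, add_comm]
  · refine unitDiff_injOn.mono fun p hp => ?_
    have hp : G.Adj p.1 p.2 := by simpa [arcSet] using hp
    exact hp.ne
  · intro hmem
    obtain ⟨p, hp, e⟩ := mem_image.1 hmem
    have hp : G.Adj p.1 p.2 := by simpa [arcSet] using hp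
    exact unitDiff_ne_zero hp.ne e

open Classical in
theorem ehrhart_two {i j : Fin n} (h : G.Adj i j) :
    ehrhart (symmetricEdgePolytope G) 2 = 1 + #(nearSet G) + #((quadSet G).image quadPoint) := by
  have hset : {z : Fin n → ℤ | (fun i => (z i : ℝ)) ∈
      open scoped Pointwise in ((2 : ℕ) : ℝ) • symmetricEdgePolytope G} =
      ((insert 0 ((nearSet G).image fun p => unitDiff p.1 p.2) ∪ (quadSet G).image quadPoint :
        Finset (Fin n → ℤ)) : Set (Fin n → ℤ)) := by
    ext z
    simp only [coe_union, coe_insert, coe_image, Set.mem_union, Set.mem_insert_iff, Set.mem_image,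
      mem_coe]
    constructor
    · intro hz
      rcases shape_of_mem (by omega) hz with rfl | ⟨-, a, b, hab, rfl⟩ |
        ⟨-, a, b, c, d, h1, h2, h3, h4, rfl⟩
      · exact Or.inl (Or.inl rfl)
      · refine Or.inl (Or.inr ⟨(a, b), ?_, rfl⟩)
        rw [nearSet, mem_filter]
        exact ⟨mem_univ _, hab, (unitDiff_mem_two_iff hab).1 hz⟩
      · refine Or.inr ⟨((a, b), (c, d)), ?_, rfl⟩
        rw [quadSet, mem_filter]
        exact ⟨mem_univ _, ⟨h1, h2, h3, h4⟩, (unitSum_sub_mem_two_iff h1 h2 h3 h4).1 hz⟩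
    · rintro ((rfl | ⟨p, hp, rfl⟩) | ⟨t, ht, rfl⟩)
      · exact zero_toReal_mem h 2
      · rw [nearSet, mem_filter] at hp
        exact (unitDiff_mem_two_iff hp.2.1).2 hp.2.2
      · rw [quadSet, mem_filter] at ht
        obtain ⟨-, ⟨h1, h2, h3, h4⟩, h5⟩ := ht
        exact (unitSum_sub_mem_two_iff h1 h2 h3 h4).2 h5
  have hnear : ∀ p ∈ nearSet G, p.1 ≠ p.2 := fun p hp => by
    rw [nearSet, mem_filter] at hp
    exact hp.2.1
  have hquad : ∀ t ∈ quadSet G, IsMatched G t := fun t ht => by simpa [quadSet] using ht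
  rw [ehrhart, hset, Set.ncard_coe_finset, card_union_of_disjoint, card_insert_of_notMem,
    card_image_of_injOn, add_comm 1]
  · exact unitDiff_injOn.mono hnear
  · intro hmem
    obtain ⟨p, hp, e⟩ := mem_image.1 hmem
    exact unitDiff_ne_zero (hnear p hp) e
  · rw [Finset.disjoint_left]
    intro z hz hz'
    obtain ⟨t, ht, rfl⟩ := mem_image.1 hz'
    rcases mem_insert.1 hz with e | hz
    · exact quadPoint_ne_zero (hquad t ht) e
    · obtain ⟨p, hp, e⟩ := mem_image.1 hz
      exact quadPoint_ne_unitDiff (hquad t ht) (hnear p hp) e.symm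

open Classical in
/-- The weight of an ordered pair for which the orderings of any unordered pair, possibly with equal
entries, have total weight two. -/
noncomputable def pairMult (p : Fin n × Fin n) : ℤ := if p.1 = p.2 then 2 else 1

theorem sum_swap_pair (i j : Fin n) :
    ∑ p ∈ ({(i, j), (j, i)} : Finset (Fin n × Fin n)), pairMult p = 2 := by
  by_cases h : i = j
  · subst h; simp [pairMult]
  · rw [sum_pair (by simp [h])]
    simp [pairMult, h, Ne.symm h]

theorem IsMatched.of_swap {i j a b i' j' a' b' : Fin n} (h : IsMatched G ((i, j), (a, b)))
    (h1 : (i' = i ∧ j' = j) ∨ (i' = j ∧ j' = i)) (h2 : (a' = a ∧ b' = b) ∨ (a' = b ∧ b' = a)) :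
    IsMatched G ((i', j'), (a', b')) := by
  unfold IsMatched at h ⊢
  rcases h1 with ⟨rfl, rfl⟩ | ⟨rfl, rfl⟩ <;> rcases h2 with ⟨rfl, rfl⟩ | ⟨rfl, rfl⟩ <;>
    simp only at h ⊢ <;> tauto

open Classical in
theorem filter_quadPoint_eq {i j a b : Fin n} (ht : IsMatched G ((i, j), (a, b))) :
    {s ∈ quadSet G | quadPoint s = quadPoint ((i, j), (a, b))} =
      ({(i, j), (j, i)} : Finset _) ×ˢ {(a, b), (b, a)} := by
  ext ⟨⟨i', j'⟩, ⟨a', b'⟩⟩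
  simp only [mem_filter, mem_product, mem_insert, mem_singleton, Prod.mk.injEq, quadSet, mem_univ,
    true_and]
  constructor
  · rintro ⟨hs, e⟩
    rw [quadPoint_eq_iff hs ht, unitSum_eq_iff, unitSum_eq_iff] at e
    exact e
  · intro e
    have hs := ht.of_swap e.1 e.2
    refine ⟨hs, ?_⟩
    rw [quadPoint_eq_iff hs ht, unitSum_eq_iff, unitSum_eq_iff]
    exact e

open Classical in
-- The fibre over a lattice point consists of the orderings of its two pairs. With the weights
-- `pairMult` each pair contributes 2, even when its entries coincide.
theorem four_mul_card_image_quadPoint : (4 * #((quadSet G).image quadPoint) : ℤ) =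
    ∑ t ∈ quadSet G, pairMult t.1 * pairMult t.2 := by
  rw [← sum_fiberwise_of_maps_to (t := (quadSet G).image quadPoint) (g := quadPoint)
    (fun t ht => mem_image_of_mem quadPoint ht), mul_comm, ← nsmul_eq_mul, ← sum_const]
  refine sum_congr rfl fun z hz => ?_
  obtain ⟨⟨⟨i, j⟩, ⟨a, b⟩⟩, ht, rfl⟩ := mem_image.1 hz
  have ht : IsMatched G ((i, j), (a, b)) := by simpa [quadSet] using ht
  rw [filter_quadPoint_eq ht, sum_product]
  simp only [← mul_sum, ← sum_mul, sum_swap_pair]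
  norm_num

end Counting

/-! ### Evaluation of the sum over matched quadruples -/

section QuadSum

variable {n : ℕ} {G : SimpleGraph (Fin n)}

open Classical in
-- Inclusion–exclusion over the two matchings. For one matching, two of the four inequalities follow
-- from adjacency; the others give factors 1 - [i = b] and 1 - [j = a] (or their analogues), and the
-- weights give (1 + [i = j])(1 + [a = b]). The mixed products omitted here would contain a loop.
theorem indicator_isMatched (i j a b : Fin n) :
    (if IsMatched G ((i, j), (a, b)) then
      pairMult (i, j) * pairMult (a, b) else 0) =
    ((adjInd G i a * adjInd G j b - (if i = b then adjInd G i a * adjInd G j b else 0) -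
        (if j = a then adjInd G i a * adjInd G j b else 0) +
        (if i = b then if j = a then adjInd G i a * adjInd G j b else 0 else 0) +
        (if i = j then adjInd G i a * adjInd G j b else 0) +
        (if a = b then adjInd G i a * adjInd G j b else 0) +
        (if i = j then if a = b then adjInd G i a * adjInd G j b else 0 else 0)) +
      (adjInd G i b * adjInd G j a - (if i = a then adjInd G i b * adjInd G j a else 0) -
        (if j = b then adjInd G i b * adjInd G j a else 0) +
        (if i = a then if j = b then adjInd G i b * adjInd G j a else 0 else 0) +
        (if i = j then adjInd G i b * adjInd G j a else 0) +
        (if a = b then adjInd G i b * adjInd G j a else 0) +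
        (if i = j then if a = b then adjInd G i b * adjInd G j a else 0 else 0))) -
      (adjInd G i a * adjInd G j b * (adjInd G i b * adjInd G j a) +
        (if i = j then adjInd G i a * adjInd G j b * (adjInd G i b * adjInd G j a) else 0) +
        (if a = b then adjInd G i a * adjInd G j b * (adjInd G i b * adjInd G j a) else 0) +
        (if i = j then if a = b then
          adjInd G i a * adjInd G j b * (adjInd G i b * adjInd G j a) else 0 else 0)) := by
  have hadj : ∀ x y, adjInd G x y = if G.Adj x y then 1 else 0 := fun _ _ => rfl
  unfold IsMatched pairMult
  simp only
  by_cases hia : i = a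
  · subst hia
    by_cases hij : i = j
    · subst hij; simp
    · by_cases hjb : j = b
      · subst hjb; simp [hij]
      · by_cases hib : i = b
        · subst hib; simp
        · simp [hij, Ne.symm hij, hjb, hib]
  by_cases hjb : j = b
  · subst hjb
    by_cases hij : i = j
    · subst hij; simp
    · by_cases hja : j = a
      · subst hja; simp
      · simp [hij, hja, hia, Ne.symm hja]
  by_cases hib : i = b
  · subst hib
    by_cases hij : i = j
    · subst hij; simp [hia]
    · by_cases hja : j = a
      · subst hja; simp [hij, Ne.symm hij]
      · simp [hij, Ne.symm hij, hja, hia, Ne.symm hia]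
  by_cases hja : j = a
  · subst hja; simp [hia, hib, hjb]
  simp only [hia, hjb, hib, hja, if_false, hadj, Ne, not_false_eq_true, and_self, true_and]
  by_cases h1 : G.Adj i a <;> by_cases h2 : G.Adj j b <;> by_cases h3 : G.Adj i b <;>
    by_cases h4 : G.Adj j a <;> simp only [h1, h2, h3, h4] <;> by_cases h5 : i = j <;>
    by_cases h6 : a = b <;> simp [h5, h6]

end QuadSum

section QuadSum

variable {n : ℕ} {G : SimpleGraph (Fin n)}

/-- The number of ordered pairs of neighbours of a vertex, summed over the vertices. -/
noncomputable def degSq (G : SimpleGraph (Fin n)) : ℤ := ∑ i, ∑ j, ∑ k, adjInd G i j * adjInd G i k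

theorem sum_codeg : ∑ i, ∑ j, codeg G i j = degSq G := by
  unfold codeg degSq
  have : ∀ i, ∑ j, ∑ x, adjInd G i x * adjInd G x j = ∑ x, ∑ j, adjInd G i x * adjInd G x j :=
    fun i => sum_comm
  simp only [this]
  rw [sum_comm]
  simp only [adjInd_comm G _ _]

/-- For each matching the `degSq` terms from disjointness cancel those from the weights, leaving
`arcs G ^ 2 + 2 * arcs G`. The subtracted part comes from quadruples admitting both matchings. -/
theorem sum_pairMult : ∑ t ∈ quadSet G, pairMult t.1 * pairMult t.2 =
    2 * (arcs G ^ 2 + 2 * arcs G) - (∑ i, ∑ j, codeg G i j ^ 2 + 2 * degSq G + arcs G) := by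
  classical
  rw [quadSet, sum_filter]
  simp only [Fintype.sum_prod_type, indicator_isMatched, sum_add_distrib, sum_sub_distrib,
    sum_ite_eq, sum_ite_irrel, sum_const_zero, mem_univ, if_true]
  have a1 : ∑ x, ∑ y, ∑ z, ∑ w, adjInd G x z * adjInd G y w = arcs G ^ 2 := by
    rw [arcs, sq, sum_mul_sum]
    exact sum_congr rfl fun x _ => sum_congr rfl fun y _ => (sum_mul_sum _ _ _ _).symm
  have a2 : ∑ x, ∑ y, ∑ z, ∑ w, adjInd G x w * adjInd G y z = arcs G ^ 2 := by
    rw [← a1]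
    exact sum_congr rfl fun x _ => sum_congr rfl fun y _ => sum_comm
  have b1 : ∑ x, ∑ y, ∑ z, adjInd G x z * adjInd G y x = degSq G := by
    refine sum_congr rfl fun x _ => sum_congr rfl fun y _ => sum_congr rfl fun z _ => ?_
    rw [adjInd_comm G y x, mul_comm]
  have b2 : ∑ x, ∑ y, ∑ z, adjInd G x y * adjInd G y z = degSq G := by
    rw [sum_comm]
    refine sum_congr rfl fun x _ => sum_congr rfl fun y _ => sum_congr rfl fun z _ => ?_
    rw [adjInd_comm G y x]
  have b3 : ∑ x, ∑ y, ∑ z, adjInd G x z * adjInd G x y = degSq G := by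
    refine sum_congr rfl fun x _ => sum_congr rfl fun y _ => sum_congr rfl fun z _ => ?_
    rw [mul_comm]
  have b4 : ∑ x, ∑ y, ∑ z, adjInd G x z * adjInd G y z = degSq G := by
    rw [← sum_codeg]
    refine sum_congr rfl fun x _ => sum_congr rfl fun y _ => sum_congr rfl fun z _ => ?_
    rw [adjInd_comm G y z]
  have c1 : ∑ x, ∑ y, adjInd G x y * adjInd G y x = arcs G := by
    refine sum_congr rfl fun x _ => sum_congr rfl fun y _ => ?_
    rw [adjInd_comm G y x, adjInd_mul_self]
  have d1 : ∑ x, ∑ y, ∑ z, ∑ w, adjInd G x z * adjInd G y w * (adjInd G x w * adjInd G y z) =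
      ∑ i, ∑ j, codeg G i j ^ 2 := by
    refine sum_congr rfl fun x _ => sum_congr rfl fun y _ => ?_
    rw [codeg, sq, sum_mul_sum]
    refine sum_congr rfl fun z _ => sum_congr rfl fun w _ => ?_
    rw [adjInd_comm G y w, adjInd_comm G y z]; ring
  have sq1 : ∀ x y z w : Fin n, adjInd G x y * adjInd G z w * (adjInd G z w * adjInd G x y) =
      adjInd G x y * adjInd G z w := fun x y z w => by
    linear_combination (adjInd G z w) * (adjInd G z w) * adjInd_mul_self G x y +
      adjInd G x y * adjInd_mul_self G z w
  have sq2 : ∀ x y z w : Fin n, adjInd G x y * adjInd G z w * (adjInd G x y * adjInd G z w) =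
      adjInd G x y * adjInd G z w := fun x y z w => by
    linear_combination sq1 x y z w
  simp only [d1, sq1, sq2, adjInd_mul_self, a1, a2, b1, b2, b3, b4, c1]
  rw [show ∑ x, ∑ y, adjInd G x y = arcs G from rfl,
    show ∑ x, ∑ y, ∑ z, adjInd G x y * adjInd G x z = degSq G from rfl]
  ring

open Classical in
theorem card_nearSet : (#(nearSet G) : ℤ) =
    ∑ i, ∑ j, if i = j then 0 else 1 - farInd G i j := by
  rw [nearSet, card_filter, Fintype.sum_prod_type]
  push_cast
  refine sum_congr rfl fun i _ => sum_congr rfl fun j _ => ?_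
  have h := codeg_eq_zero_iff G (i := i) (j := j)
  unfold farInd
  by_cases hij : i = j
  · simp [hij]
  · by_cases hadj : G.Adj i j
    · simp [hij, hadj]
    · by_cases hc : codeg G i j = 0
      · have : ¬ ∃ x, G.Adj i x ∧ G.Adj x j := by push Not; simpa using h.1 hc
        simp [hij, hadj, hc, this]
      · have : ∃ x, G.Adj i x ∧ G.Adj x j := by
          by_contra hcon
          exact hc (h.2 (by simpa using hcon))
        simp [hij, hadj, hc, this]

theorem totalWeight_eq : totalWeight G =
    ∑ i, ∑ j, codeg G i j ^ 2 + 2 * degSq G + arcs G - 4 * #(nearSet G) := by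
  classical
  have hdiag : ∀ i, codeg G i i = ∑ j, adjInd G i j := fun i => by
    refine sum_congr rfl fun x _ => ?_
    rw [adjInd_comm G x i, adjInd_mul_self]
  have h1 : totalWeight G = ∑ i, ∑ j, (codeg G i j ^ 2 + 3 * codeg G i j + 4 * adjInd G i j -
      (if i = j then codeg G i j ^ 2 + 3 * codeg G i j else 0) -
      4 * (if i = j then 0 else 1 - farInd G i j)) := by
    unfold totalWeight pairWeight
    refine sum_congr rfl fun i _ => sum_congr rfl fun j _ => ?_
    split_ifs with h
    · subst h; simp
    · ring
  have h2 : ∑ i, (∑ j, adjInd G i j) ^ 2 = degSq G := by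
    simp only [sq, sum_mul_sum, degSq]
  rw [h1, card_nearSet]
  simp only [sum_add_distrib, sum_sub_distrib, ← mul_sum, sum_ite_eq, mem_univ, if_true, hdiag,
    sum_codeg, h2]
  rw [show ∑ x, ∑ y, adjInd G x y = arcs G from rfl]
  ring

theorem four_mul_ehrhart_two {i j : Fin n} (h : G.Adj i j) :
    (4 * ehrhart (symmetricEdgePolytope G) 2 : ℤ) =
      4 + 2 * arcs G ^ 2 + 4 * arcs G - totalWeight G := by
  classical
  have h1 := four_mul_card_image_quadPoint (G := G)
  rw [sum_pairMult] at h1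
  rw [ehrhart_two h, totalWeight_eq]
  push_cast
  linear_combination h1

end QuadSum

/-! ### The dimension, and the second entry of the `γ`-vector -/

section Dimension

variable {n : ℕ} {G : SimpleGraph (Fin n)}

theorem vectorSpan_symmetricEdgePolytope {i j : Fin n} (h : G.Adj i j) :
    vectorSpan ℝ (symmetricEdgePolytope G) = Submodule.span ℝ
      {x | ∃ i j : Fin n, G.Adj i j ∧ x = Pi.single i (1 : ℝ) - Pi.single j (1 : ℝ)} := by
  have h0 := zero_mem_symmetricEdgePolytope h
  rw [vectorSpan_eq_span_vsub_set_right ℝ h0]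
  simp only [vsub_eq_sub, sub_zero, Set.image_id']
  refine le_antisymm (Submodule.span_le.2 ?_) (Submodule.span_mono (subset_convexHull ℝ _))
  exact convexHull_min Submodule.subset_span (Submodule.convex _)

theorem single_sub_single_mem_span (h : G.Connected) (i j : Fin n) :
    (Pi.single i (1 : ℝ) - Pi.single j (1 : ℝ) : Fin n → ℝ) ∈ Submodule.span ℝ
      {x | ∃ i j : Fin n, G.Adj i j ∧ x = Pi.single i (1 : ℝ) - Pi.single j (1 : ℝ)} := by
  obtain ⟨p⟩ := h.preconnected i j
  induction p with
  | nil => rw [sub_self]; exact Submodule.zero_mem _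
  | @cons u v w hadj _ ih =>
    rw [← sub_add_sub_cancel _ (Pi.single v (1 : ℝ))]
    exact Submodule.add_mem _ (Submodule.subset_span ⟨u, v, hadj, rfl⟩) ih

/-- By telescoping along walks, the edge differences of a connected graph span the hyperplane of
vectors with coordinate sum 0. -/
theorem polytopeDim_symmetricEdgePolytope (h : G.Connected) {a b : Fin n} (hab : G.Adj a b) :
    polytopeDim (symmetricEdgePolytope G) + 1 = n := by
  let φ : (Fin n → ℝ) →ₗ[ℝ] ℝ := ∑ i, LinearMap.proj i
  have hφ : ∀ x, φ x = ∑ i, x i := fun x => by simp [φ]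
  have hker : vectorSpan ℝ (symmetricEdgePolytope G) = LinearMap.ker φ := by
    rw [vectorSpan_symmetricEdgePolytope hab]
    refine le_antisymm (Submodule.span_le.2 ?_) fun x hx => ?_
    · rintro _ ⟨i, j, -, rfl⟩
      simp [hφ, Pi.single_apply]
    · rw [LinearMap.mem_ker, hφ] at hx
      have : x = ∑ i, x i • (Pi.single i (1 : ℝ) - Pi.single a (1 : ℝ) : Fin n → ℝ) := by
        simp only [smul_sub, sum_sub_distrib, ← sum_smul, hx, zero_smul, sub_zero]
        ext k
        simp [Pi.single_apply]
      rw [this]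
      exact Submodule.sum_mem _ fun i _ =>
        Submodule.smul_mem _ _ (single_sub_single_mem_span h i a)
  have hrange : LinearMap.range φ = ⊤ := LinearMap.range_eq_top.2 fun c =>
    ⟨Pi.single a c, by simp [hφ, Pi.single_apply]⟩
  have := φ.finrank_range_add_finrank_ker
  rw [hrange, finrank_top, Module.finrank_self, Module.finrank_fin_fun] at this
  rw [polytopeDim, hker]
  omega

theorem coeff_one_sub_X_pow (N : ℕ) :
    PowerSeries.coeff 0 ((1 - PowerSeries.X : PowerSeries ℤ) ^ N) = 1 ∧
    PowerSeries.coeff 1 ((1 - PowerSeries.X : PowerSeries ℤ) ^ N) = -N ∧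
    2 * PowerSeries.coeff 2 ((1 - PowerSeries.X : PowerSeries ℤ) ^ N) = N * (N - 1) := by
  induction N with
  | zero => simp [PowerSeries.coeff_one]
  | succ N ih =>
    obtain ⟨h0, h1, h2⟩ := ih
    simp only [pow_succ, mul_sub, mul_one, map_sub]
    rw [PowerSeries.coeff_zero_mul_X, show (1 : ℕ) = 0 + 1 from rfl, PowerSeries.coeff_succ_mul_X,
      show (2 : ℕ) = 1 + 1 from rfl, PowerSeries.coeff_succ_mul_X]
    simp only [zero_add, Nat.reduceAdd] at *
    refine ⟨by rw [h0]; ring, by rw [h0, h1]; push_cast; ring, ?_⟩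
    push_cast
    linear_combination h2 - 2 * h1

theorem hStarOfEhrhart_zero (d : ℕ) (E : ℕ → ℤ) : hStarOfEhrhart d E 0 = E 0 := by
  rw [hStarOfEhrhart, PowerSeries.coeff_mul]
  simp [(coeff_one_sub_X_pow (d + 1)).1]

theorem hStarOfEhrhart_one (d : ℕ) (E : ℕ → ℤ) :
    hStarOfEhrhart d E 1 = E 1 - (d + 1) * E 0 := by
  obtain ⟨h0, h1, -⟩ := coeff_one_sub_X_pow (d + 1)
  rw [hStarOfEhrhart, PowerSeries.coeff_mul, Finset.Nat.sum_antidiagonal_eq_sum_range_succ_mk]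
  simp only [sum_range_succ, range_zero, sum_empty, PowerSeries.coeff_mk, h0, h1]
  push_cast; simp; ring

theorem two_mul_hStarOfEhrhart_two (d : ℕ) (E : ℕ → ℤ) :
    2 * hStarOfEhrhart d E 2 = 2 * E 2 - 2 * (d + 1) * E 1 + (d + 1) * d * E 0 := by
  obtain ⟨h0, h1, h2⟩ := coeff_one_sub_X_pow (d + 1)
  rw [hStarOfEhrhart, PowerSeries.coeff_mul, Finset.Nat.sum_antidiagonal_eq_sum_range_succ_mk]
  simp only [sum_range_succ, range_zero, sum_empty, PowerSeries.coeff_mk, h0, h1]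
  simp only [zero_add, tsub_zero, tsub_self, Nat.add_one_sub_one]
  push_cast at h2 ⊢
  linear_combination E 0 * h2

theorem gammaOfH_two {d : ℕ} (hd : 4 ≤ d) (h : ℕ → ℤ) :
    2 * gammaOfH d h 2 = 2 * h 2 - h 0 * (d * (d - 1)) - 2 * (h 1 - h 0 * d) * (d - 2) := by
  have g0 : gammaOfH d h 0 = h 0 := by
    rw [gammaOfH, if_pos (by omega)]; simp
  have g1 : gammaOfH d h 1 = h 1 - h 0 * d := by
    rw [gammaOfH, if_pos (by omega)]; simp [g0]
  have hc : (2 : ℤ) * (d.choose 2 : ℕ) = d * (d - 1) := by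
    have := Nat.choose_two_right d
    have h2 : 2 * d.choose 2 = d * (d - 1) := by
      rw [this]; exact Nat.mul_div_cancel' (Nat.even_mul_pred_self d).two_dvd
    have h3 : ((d - 1 : ℕ) : ℤ) = d - 1 := by omega
    rw [← h3]
    exact_mod_cast h2
  have h4 : ((d - 2 : ℕ) : ℤ) = d - 2 := by omega
  rw [gammaOfH, if_pos (by omega), Fin.sum_univ_two]
  simp only [Fin.val_zero, Fin.val_one, g0, g1, mul_zero, mul_one, tsub_zero, Nat.add_one_sub_one,
    Nat.choose_one_right, h4]
  linear_combination -(h 0) * hc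

/-- The dimension n - 1 is at least 4, so the entry of index 2 is not cut off by the convention and
is a linear combination of the numbers of lattice points in the dilations 0, 1 and 2. -/
theorem four_mul_gammaEntry_two (h : G.Connected) (hn : 5 ≤ n) :
    4 * gammaEntry (symmetricEdgePolytope G) 2 = gammaForm G := by
  have : Nontrivial (Fin n) := Fin.nontrivial_iff_two_le.2 (by omega)
  obtain ⟨b, hab⟩ := h.preconnected.exists_adj_of_nontrivial ⟨0, by omega⟩
  have hd := polytopeDim_symmetricEdgePolytope h hab
  have hdz : (n : ℤ) = polytopeDim (symmetricEdgePolytope G) + 1 := by exact_mod_cast hd.symm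
  have h0 := ehrhart_zero hab
  have h1 := ehrhart_one hab
  have h2 := four_mul_ehrhart_two hab
  have hg := gammaOfH_two (d := polytopeDim (symmetricEdgePolytope G)) (by omega)
    (hStar (symmetricEdgePolytope G))
  have e2 := two_mul_hStarOfEhrhart_two (polytopeDim (symmetricEdgePolytope G))
    (fun k => (ehrhart (symmetricEdgePolytope G) k : ℤ))
  unfold gammaEntry gammaForm cyc2
  rw [show hStar (symmetricEdgePolytope G) 0 = 1 by
    rw [hStar, hStarOfEhrhart_zero, h0]; rfl, show hStar (symmetricEdgePolytope G) 1 = _ by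
    rw [hStar, hStarOfEhrhart_one, h0, h1]] at hg
  simp only [h0, h1] at e2
  rw [Fintype.card_fin, hdz]
  rw [show hStarOfEhrhart _ _ 2 = hStar (symmetricEdgePolytope G) 2 from rfl] at e2
  push_cast at hg e2
  linear_combination 2 * hg + 2 * e2 + h2

end Dimension

theorem mainTheorem2 (n : ℕ) (G : SimpleGraph (Fin n)) (hG : IsTwoConnected G) :
    gammaEntry (symmetricEdgePolytope G) 2 = 0 ↔
      n < 5 ∨
        (5 ≤ n ∧
          (Nonempty (G ≃g graphGn n) ∨
            Nonempty (G ≃g completeBipartiteGraph (Fin 2) (Fin (n - 2))))) := by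
  rcases lt_or_ge n 5 with hn | hn
  · refine iff_of_true ?_ (Or.inl hn)
    have : Nontrivial (Fin n) := Fin.nontrivial_iff_two_le.2 (by have := hG.1; omega)
    obtain ⟨b, hab⟩ := hG.2.1.preconnected.exists_adj_of_nontrivial ⟨0, by have := hG.1; omega⟩
    have hd := polytopeDim_symmetricEdgePolytope hG.2.1 hab
    -- Here d = n - 1 ≤ 3, so 2 > ⌊d/2⌋ and the entry is 0 by convention.
    rw [gammaEntry, gammaOfH, if_neg (by omega)]
  · rw [or_iff_right (by omega), and_iff_right hn, ← gammaForm_eq_zero_iff hG hn,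
      ← four_mul_gammaEntry_two hG.2.1 hn]
    omega
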